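/- Let $a:[0,1]\to\mathbb R$ satisfy $a(0)=0$ and $a>0$ on $(0,1]$, and put $K:=\sup_{x\in(0,1]}\frac{x|a'(x)|}{a(x)}$. Assume that $a$ is either weakly degenerate at $0$, i.e. $a\in C[0,1]\cap C^1(0,1]$ and $K\in(0,1)$, or strongly degenerate at $0$, i.e. $a\in C^1[0,1]$ and $K\in[1,2)$. Let $L^2_{1/a}(0,1)$ be the space of $u\in L^2(0,1)$ with $\|u\|^2_{L^2_{1/a}}=\int_0^1\frac{u^2}{a}\,dx<\infty$, let $H^2_{1/a}(0,1)=L^2_{1/a}(0,1)\cap H^2_0(0,1)$ with $\|u\|^2=\int_0^1\frac{u^2}{a}\,dx+\int_0^1(u'')^2dx$, and let $Au=au''''$ with $D(A)=\{u\in H^2_{1/a}(0,1): au''''\in L^2_{1/a}(0,1)\}$. Consider $$y_{tt}+a\,y_{xxxx}=0 \ \text{ in } (0,\infty)\times(0,1),\qquad y(t,0)=y(t,1)=y_x(t,0)=y_x(t,1)=0 ,\tag{P}$$ i.e. $\dot U=\mathcal A U$ for $U=(y,y_t)$ in $\mathcal H_0=H^2_{1/a}(0,1)\times L^2_{1/a}(0,1)$,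 where $\mathcal A(u,v)=(v,-Au)$, $D(\mathcal A)=D(A)\times H^2_{1/a}(0,1)$. A mild solution of (P) is a $y$ such that $U=(y,y_t)\in C([0,\infty);\mathcal H_0)$, $\int_0^tU\,ds\in D(\mathcal A)$ and $U(t)=U(0)+\mathcal A\int_0^tU\,ds$ for all $t\ge0$; it is classical if $y\in C^2([0,\infty);L^2_{1/a})\cap C^1([0,\infty);H^2_{1/a})\cap C([0,\infty);D(A))$ and $y_{tt}+Ay=0$ for all $t\ge 0$. The energy is $E_y(t)=\frac12\int_0^1\left(\frac{y_t^2(t,x)}{a(x)}+y_{xx}^2(t,x)\right)dx$. For a mild solution $y$ and $T>0$, let $y_{xx}(\cdot,1)\in L^2(0,T)$ denote the limit in $L^2(0,T)$ of $y^n_{xx}(\cdot,1)$ for classical solutions $y^n$ of (P) with $(y^n(0),y^n_t(0))\to(y(0),y_t(0))$ in $\mathcal H_0$ (for classical solutions, $y^n_{xx}(t,\cdot)$ is continuous on $(0,1]$). **Theorem.** Let $a$ be weakly or strongly degenerate at $0$ and let $y$ be a mild solution of (P). Then, for every $T>0$, the trace $y_{xx}(\cdot,1)\in L^2(0,T)$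 exists and is unique, and $$\int_0^T y_{xx}^2(t,1)\,dt\ \ge\ \left(T(2-K)-4\max\left\{1,\frac{4}{a(1)},\frac{4K}{a(1)}\right\}\right)E_y(0).$$ -/

import Mathlib

open Set Filter Topology MeasureTheory
open scoped ContDiff ENNReal

noncomputable section

namespace DegBeam

/-! ### Degenerate coefficients -/

/-- The degeneracy constant `K = sup_{x ∈ (0,1]} x |a'(x)| / a(x)`
(the derivative at `x = 1` is the left one). -/
def degK (a : ℝ → ℝ) : ℝ :=
  sSup ((fun x => x * |derivWithin a (Ioc 0 1) x| / a x) '' Ioc (0 : ℝ) 1)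

/-- `a` is weakly degenerate at `0`. -/
structure WeaklyDegenerate (a : ℝ → ℝ) : Prop where
  cont : ContinuousOn a (Icc 0 1)
  contDiff : ContDiffOn ℝ 1 a (Ioc 0 1)
  zero : a 0 = 0
  pos : ∀ x ∈ Ioc (0 : ℝ) 1, 0 < a x
  bdd : BddAbove ((fun x => x * |derivWithin a (Ioc 0 1) x| / a x) '' Ioc (0 : ℝ) 1)
  K_mem : degK a ∈ Ioo (0 : ℝ) 1

/-- `a` is strongly degenerate at `0`. -/
structure StronglyDegenerate (a : ℝ → ℝ) : Prop where
  contDiff : ContDiffOn ℝ 1 a (Icc 0 1)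
  zero : a 0 = 0
  pos : ∀ x ∈ Ioc (0 : ℝ) 1, 0 < a x
  bdd : BddAbove ((fun x => x * |derivWithin a (Ioc 0 1) x| / a x) '' Ioc (0 : ℝ) 1)
  K_mem : degK a ∈ Ico (1 : ℝ) 2

/-! ### Function spaces on `(0,1)` -/

/-- Lebesgue measure on `(0,1)`. -/
abbrev unitVol : Measure ℝ := volume.restrict (Ioo 0 1)

/-- The measure `dx / a(x)` on `(0,1)`. -/
abbrev wMeasure (a : ℝ → ℝ) : Measure ℝ :=
  unitVol.withDensity (fun x => ENNReal.ofReal (1 / a x))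

/-- `L²(0,1)`. -/
abbrev L2 : Type := Lp ℝ 2 unitVol

/-- `L²_{1/a}(0,1)`, with norm `‖u‖² = ∫₀¹ u²/a dx`. As `a` is bounded on `[0,1]`, finiteness of this
integral implies `u ∈ L²(0,1)`. -/
abbrev L2w (a : ℝ → ℝ) : Type := Lp ℝ 2 (wMeasure a)

/-- `g` is the weak derivative of `f` on `(0,1)`. -/
def HasWeakDeriv (f g : ℝ → ℝ) : Prop :=
  LocallyIntegrableOn f (Ioo 0 1) ∧ LocallyIntegrableOn g (Ioo 0 1) ∧
    ∀ φ : ℝ → ℝ, ContDiff ℝ ∞ φ → HasCompactSupport φ → tsupport φ ⊆ Ioo 0 1 →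
      ∫ x in Ioo (0 : ℝ) 1, f x * deriv φ x = - ∫ x in Ioo (0 : ℝ) 1, g x * φ x

/-- `u` belongs to `H²₀(0,1)` (it has a representative `f` continuous on `[0,1]` with weak derivative
`f₁` continuous on `[0,1]`, both vanishing at the end points), with weak second derivative `w`.
Equality is almost everywhere for `dx / a`. -/
def IsH20 (a : ℝ → ℝ) (u w : ℝ → ℝ) : Prop :=
  ∃ f f₁ : ℝ → ℝ, ContinuousOn f (Icc 0 1) ∧ ContinuousOn f₁ (Icc 0 1) ∧
    f 0 = 0 ∧ f 1 = 0 ∧ f₁ 0 = 0 ∧ f₁ 1 = 0 ∧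
    u =ᵐ[wMeasure a] f ∧ HasWeakDeriv f f₁ ∧ HasWeakDeriv f₁ w

lemma integrable_mul_test {f φ : ℝ → ℝ} (hf : LocallyIntegrableOn f (Ioo 0 1))
    (hφ : Continuous φ) (hc : HasCompactSupport φ) (hs : tsupport φ ⊆ Ioo 0 1) :
    Integrable (fun x => f x * φ x) unitVol := by
  have h1 : IntegrableOn f (tsupport φ) :=
    (hf.mono_set hs).integrableOn_isCompact hc
  have h2 : IntegrableOn (fun x => f x * φ x) (tsupport φ) :=
    h1.mul_continuousOn hφ.continuousOn hc
  have h3 : Integrable (fun x => f x * φ x) := by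
    refine (integrableOn_iff_integrable_of_support_subset ?_).1 h2
    intro x hx
    refine subset_tsupport φ ?_
    intro h
    exact hx (by simp [h])
  exact h3.integrableOn

lemma HasWeakDeriv.add {f g f' g' : ℝ → ℝ} (h : HasWeakDeriv f g) (h' : HasWeakDeriv f' g') :
    HasWeakDeriv (fun x => f x + f' x) (fun x => g x + g' x) := by
  refine ⟨h.1.add h'.1, h.2.1.add h'.2.1, fun φ hφ hc hs => ?_⟩
  have hd : Continuous (deriv φ) := hφ.continuous_deriv (by simp)
  have hcd : HasCompactSupport (deriv φ) := hc.deriv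
  have hsd : tsupport (deriv φ) ⊆ Ioo 0 1 := (closure_minimal (support_deriv_subset)
    (isClosed_tsupport φ)).trans hs
  simp only [add_mul]
  rw [integral_add (integrable_mul_test h.1 hd hcd hsd) (integrable_mul_test h'.1 hd hcd hsd),
    integral_add (integrable_mul_test h.2.1 hφ.continuous hc hs)
      (integrable_mul_test h'.2.1 hφ.continuous hc hs), h.2.2 φ hφ hc hs, h'.2.2 φ hφ hc hs]
  ring

lemma HasWeakDeriv.const_mul {f g : ℝ → ℝ} (c : ℝ) (h : HasWeakDeriv f g) :
    HasWeakDeriv (fun x => c * f x) (fun x => c * g x) := by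
  refine ⟨h.1.smul c, h.2.1.smul c, fun φ hφ hc hs => ?_⟩
  simp only [mul_assoc, integral_const_mul]
  rw [h.2.2 φ hφ hc hs]
  ring

lemma HasWeakDeriv.congr_right {f g g' : ℝ → ℝ} (h : HasWeakDeriv f g) (hg : g =ᵐ[unitVol] g') :
    HasWeakDeriv f g' := by
  refine ⟨h.1, h.2.1.congr hg, fun φ hφ hc hs => ?_⟩
  rw [h.2.2 φ hφ hc hs]
  congr 1
  refine integral_congr_ae ?_
  filter_upwards [hg] with x hx
  rw [hx]

/-- `H²_{1/a}(0,1) = L²_{1/a}(0,1) ∩ H²₀(0,1)`: an element is stored as the pair `(u, u'')`, so that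
its norm is `‖u‖² = ∫₀¹ u²/a dx + ∫₀¹ (u'')² dx`. -/
def H2w (a : ℝ → ℝ) : Submodule ℝ (WithLp 2 (L2w a × L2)) where
  carrier := {p | IsH20 a p.fst p.snd}
  zero_mem' := by
    have h0 : HasWeakDeriv (fun _ => 0) (fun _ => 0) :=
      ⟨locallyIntegrableOn_const 0, locallyIntegrableOn_const 0, by simp⟩
    exact ⟨fun _ => 0, fun _ => 0, continuousOn_const, continuousOn_const, rfl, rfl, rfl, rfl,
      Lp.coeFn_zero _ _ _, h0, h0.congr_right (Lp.coeFn_zero ℝ 2 unitVol).symm⟩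
  add_mem' := by
    rintro p q ⟨f, f₁, h1, h2, h3, h4, h5, h6, h7, h8, h9⟩
      ⟨g, g₁, k1, k2, k3, k4, k5, k6, k7, k8, k9⟩
    refine ⟨fun x => f x + g x, fun x => f₁ x + g₁ x, h1.add k1, h2.add k2, by simp [*], by simp [*],
      by simp [*], by simp [*], ?_, h8.add k8, (h9.add k9).congr_right ?_⟩
    · filter_upwards [Lp.coeFn_add p.fst q.fst, h7, k7] with x e1 e2 e3
      rw [← e2, ← e3]
      exact e1
    · exact (Lp.coeFn_add p.snd q.snd).symm
  smul_mem' := by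
    rintro c p ⟨f, f₁, h1, h2, h3, h4, h5, h6, h7, h8, h9⟩
    refine ⟨fun x => c * f x, fun x => c * f₁ x, h1.const_smul c, h2.const_smul c, by simp [*],
      by simp [*], by simp [*], by simp [*], ?_, h8.const_mul c, (h9.const_mul c).congr_right ?_⟩
    · filter_upwards [Lp.coeFn_smul c p.fst, h7] with x e1 e2
      rw [← e2]
      exact e1
    · exact (Lp.coeFn_smul c p.snd).symm

variable {a : ℝ → ℝ}

/-- The inclusion `H²_{1/a}(0,1) → L²_{1/a}(0,1)`. -/
def incl (u : H2w a) : L2w a := (u : WithLp 2 (L2w a × L2)).fst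

/-- The weak second derivative `u'' ∈ L²(0,1)` of `u ∈ H²_{1/a}(0,1)`. -/
def dd (u : H2w a) : L2 := (u : WithLp 2 (L2w a × L2)).snd

/-- `u ∈ D(A)` and `A u = a u'''' = w`: the weak fourth derivative of `u` exists on `(0,1)` and
`a u''''` is the element `w` of `L²_{1/a}(0,1)`. -/
def HasA (u : H2w a) (w : L2w a) : Prop :=
  ∃ f₃ f₄ : ℝ → ℝ, HasWeakDeriv (dd u) f₃ ∧ HasWeakDeriv f₃ f₄ ∧
    w =ᵐ[wMeasure a] fun x => a x * f₄ x

/-! ### Solutions of `y_tt + a y_xxxx = 0` with clamped ends -/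

/-- `y` is a mild solution on `[0,∞)`, with time derivative `yt`. This is the standard notion of mild
solution of `U' = 𝒜 U`, `U = (y, y_t)`, `𝒜 (u, v) = (v, - A u)` on `H²_{1/a} × L²_{1/a}`, written in
components: `U` is continuous, `∫₀ᵗ U ds ∈ D(A) × H²_{1/a}` and `U(t) = U(0) + 𝒜 ∫₀ᵗ U ds`.
(The first component of the last equation is `y(t) = y(0) + ∫₀ᵗ y_t ds`.) -/
structure IsMildSolution (a : ℝ → ℝ) (y : ℝ → H2w a) (yt : ℝ → L2w a) : Prop where
  cont : ContinuousOn y (Ici 0)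
  cont_t : ContinuousOn yt (Ici 0)
  deriv_t : ∀ t, 0 ≤ t → HasDerivWithinAt (fun s => incl (y s)) (yt t) (Ici 0) t
  eqn : ∀ t, 0 ≤ t → ∃ z : H2w a, incl z = ∫ s in (0 : ℝ)..t, incl (y s) ∧ HasA z (yt 0 - yt t)

/-- `y` is a classical solution on `[0,∞)`, with time derivative `yt`: it is of class
`C²([0,∞); L²_{1/a}) ∩ C¹([0,∞); H²_{1/a}) ∩ C([0,∞); D(A))` and `y_tt + A y = 0` for all `t ≥ 0`
(continuity of `A y` is that of `y_tt`). -/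
structure IsClassicalSolution (a : ℝ → ℝ) (y yt : ℝ → H2w a) : Prop where
  deriv_t : ∀ t, 0 ≤ t → HasDerivWithinAt y (yt t) (Ici 0) t
  cont_t : ContinuousOn yt (Ici 0)
  eqn : ∃ ytt : ℝ → L2w a, ContinuousOn ytt (Ici 0) ∧ ∀ t, 0 ≤ t →
    HasDerivWithinAt (fun s => incl (yt s)) (ytt t) (Ici 0) t ∧ HasA (y t) (- ytt t)

/-- The energy `½ ∫₀¹ (v²/a + (u'')²) dx` of a state `(u, v)`. -/
def energy (u : H2w a) (v : L2w a) : ℝ :=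
  1 / 2 * ∫ x in Ioo (0 : ℝ) 1, ((v x) ^ 2 / a x + (dd u x) ^ 2)

/-- `u''(1) = c`, for the representative of `u''` that is continuous on `(0,1]`. -/
def HasSecondDerivAtOne (u : H2w a) (c : ℝ) : Prop :=
  ∃ f : ℝ → ℝ, ContinuousOn f (Ioc 0 1) ∧ dd u =ᵐ[unitVol] f ∧ f 1 = c

/-- `g` is the boundary observation `y_xx(·,1) ∈ L²(0,T)` of the solution with initial data
`(y0, y1)`: the limit in `L²(0,T)` of the observations of classical solutions whose initial data
converge to `(y0, y1)` in `H²_{1/a} × L²_{1/a}`. -/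
def IsBoundaryTrace (T : ℝ) (y0 : H2w a) (y1 : L2w a)
    (g : Lp ℝ 2 ((volume : Measure ℝ).restrict (Ioo 0 T))) : Prop :=
  ∃ (z zt : ℕ → ℝ → H2w a) (b : ℕ → Lp ℝ 2 ((volume : Measure ℝ).restrict (Ioo 0 T))),
    (∀ n, IsClassicalSolution a (z n) (zt n)) ∧
    Tendsto (fun n => z n 0) atTop (𝓝 y0) ∧
    Tendsto (fun n => incl (zt n 0)) atTop (𝓝 y1) ∧
    (∀ n, ∀ᵐ t ∂(volume : Measure ℝ).restrict (Ioo 0 T), HasSecondDerivAtOne (z n t) (b n t)) ∧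
    Tendsto b atTop (𝓝 g)

end DegBeam

end

/-! For classical solutions the energy is constant, and the inequality comes from two multipliers.
With `ρ = ∫ y_t x y_x / a`, the identity `∫ u'''' x u' = 3/2 ‖u''‖² - 1/2 u''(1)²` (`inner_opN_eq`)
and the estimate `|∫ v x v' / a + 1/2 ‖v‖²| ≤ K/2 ‖v‖²` (`abs_inner_opN_add_le`), the latter from
`|x a'| ≤ K a`, express `y_xx(t,1)²` through `ρ'` and the energy. The second multiplier `B = ∫ y_t y
/ a` has `B' = ‖y_t‖² - ‖y_xx‖²` and corrects the balance between kinetic and potential energy.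
Integration in time leaves only values of `ρ` and `B` at `0` and `T`, which are bounded by multiples
of the energy. The same computation gives the direct inequality `∫ y_xx(t,1)² ≤ C E`
(`IsClassicalSolution.exists_trace`).

The difficulty is the degeneracy at `x = 0`. Since `K < 2`, the function `x² / a` is nondecreasing,
so `1/a ≤ 1 / (a(1) x²)`. Hence functions that are `O(x)` lie in `L²_{1/a}`, and if `a u'''' ∈
L²_{1/a}` then `u''' = O(x^(-1/2))` and `u''` is bounded. An element of `H²_{1/a}` is `O(x^(3/2))`
with derivative `O(x^(1/2))`, so every boundary term at `0` vanishes. Weak derivatives are replaced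
throughout by Lebesgue primitives, for which the product rule holds.

The passage to mild solutions needs density of classical initial data. An element of `H²_{1/a}` is
determined by `p = u''`, which ranges over the orthogonal complement of `1` and `x` in `L²(0,1)`;
let `J` send `p` to `u ∈ L²_{1/a}`. Then `J J*` inverts `A`, and it is compact by Arzelà–Ascoli,
symmetric and injective. Its eigenfunctions span a dense subspace and generate the explicit
classical solutions `cos(νt) u` and `ν⁻¹ sin(νt) u` (`dense_classicalData`). The direct inequality,
applied to differences of classical solutions, shows that their observations form Cauchy sequences
with a limit depending only on the limiting data; the inverse inequality passes to that limit. -/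

noncomputable section

namespace DegBeam

variable {a : ℝ → ℝ}

/-! ### Primitives -/

/-- `G` is a primitive of `g` on `s`, in the sense of Lebesgue integrals. -/
def IsPrimitiveOn (G g : ℝ → ℝ) (s : Set ℝ) : Prop :=
  ∀ x ∈ s, ∀ y ∈ s, IntervalIntegrable g volume x y ∧ ∫ t in x..y, g t = G y - G x

namespace IsPrimitiveOn

variable {F G f g : ℝ → ℝ} {s t : Set ℝ}

lemma mono (h : IsPrimitiveOn G g s) (hts : t ⊆ s) : IsPrimitiveOn G g t :=
  fun x hx y hy => h x (hts hx) y (hts hy)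

lemma integral_eq (h : IsPrimitiveOn G g s) {x y : ℝ} (hx : x ∈ s) (hy : y ∈ s) :
    ∫ t in x..y, g t = G y - G x := (h x hx y hy).2

lemma intervalIntegrable (h : IsPrimitiveOn G g s) {x y : ℝ} (hx : x ∈ s) (hy : y ∈ s) :
    IntervalIntegrable g volume x y := (h x hx y hy).1

lemma congr_left (h : IsPrimitiveOn G g s) (hF : EqOn F G s) : IsPrimitiveOn F g s :=
  fun x hx y hy => ⟨(h x hx y hy).1, by rw [(h x hx y hy).2, hF hx, hF hy]⟩

lemma add (h : IsPrimitiveOn F f s) (h' : IsPrimitiveOn G g s) :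
    IsPrimitiveOn (fun x => F x + G x) (fun x => f x + g x) s := by
  intro x hx y hy
  refine ⟨(h x hx y hy).1.add (h' x hx y hy).1, ?_⟩
  rw [intervalIntegral.integral_add (h x hx y hy).1 (h' x hx y hy).1, (h x hx y hy).2,
    (h' x hx y hy).2]
  ring

lemma const_mul (h : IsPrimitiveOn F f s) (c : ℝ) :
    IsPrimitiveOn (fun x => c * F x) (fun x => c * f x) s := by
  intro x hx y hy
  refine ⟨(h x hx y hy).1.const_mul c, ?_⟩
  rw [intervalIntegral.integral_const_mul, (h x hx y hy).2]
  ring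

lemma sub (h : IsPrimitiveOn F f s) (h' : IsPrimitiveOn G g s) :
    IsPrimitiveOn (fun x => F x - G x) (fun x => f x - g x) s := by
  have := h.add (h'.const_mul (-1))
  simpa [sub_eq_add_neg] using this

lemma const (c : ℝ) : IsPrimitiveOn (fun _ => c) (fun _ => 0) s :=
  fun _ _ _ _ => ⟨intervalIntegrable_const, by simp⟩

lemma of_hasDerivAt (h : ∀ x, HasDerivAt G (g x) x) (hg : Continuous g) : IsPrimitiveOn G g s :=
  fun _ _ _ _ => ⟨hg.intervalIntegrable _ _,
    intervalIntegral.integral_eq_sub_of_hasDerivAt (fun z _ => h z) (hg.intervalIntegrable _ _)⟩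

lemma id : IsPrimitiveOn (fun x => x) (fun _ => 1) s :=
  of_hasDerivAt (fun x => hasDerivAt_id x) continuous_const

/-- On the interval, `G` equals `G x` plus the integral of `g` from `x`. Absolute continuity
involves only values at points of the interval, so it transfers from that integral. -/
lemma absolutelyContinuous (h : IsPrimitiveOn G g s) [hs : s.OrdConnected] {x y : ℝ} (hx : x ∈ s)
    (hy : y ∈ s) : AbsolutelyContinuousOnInterval G x y := by
  have h1 := (h x hx y hy).1.absolutelyContinuousOnInterval_intervalIntegral
    (c := x) left_mem_uIcc
  have h2 : AbsolutelyContinuousOnInterval (fun _ : ℝ => G x) x y :=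
    (contDiffOn_const (n := 1)).absolutelyContinuousOnInterval
  have h3 := h1.add h2
  rw [absolutelyContinuousOnInterval_iff] at h3 ⊢
  intro ε hε
  obtain ⟨δ, hδ, H⟩ := h3 ε hε
  refine ⟨δ, hδ, fun E hE hl => ?_⟩
  refine lt_of_eq_of_lt (Finset.sum_congr rfl fun i hi => ?_) (H E hE hl)
  have hE' := hE.1 i hi
  have hsub : uIcc x y ⊆ s := hs.uIcc_subset hx hy
  simp only [Pi.add_apply]
  rw [(h x hx _ (hsub hE'.1)).2, (h x hx _ (hsub hE'.2)).2]
  simp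

lemma continuousOn_uIcc (h : IsPrimitiveOn G g s) [s.OrdConnected] {x y : ℝ} (hx : x ∈ s)
    (hy : y ∈ s) : ContinuousOn G (uIcc x y) :=
  (h.absolutelyContinuous hx hy).continuousOn

lemma continuousOn_Icc {a b : ℝ} (h : IsPrimitiveOn G g (Icc a b)) : ContinuousOn G (Icc a b) := by
  rcases lt_or_ge b a with hab | hab
  · simp [Icc_eq_empty (not_le.2 hab)]
  · rw [← uIcc_of_le hab] at h ⊢
    exact h.continuousOn_uIcc left_mem_uIcc right_mem_uIcc

lemma continuousOn_Ioc {a b : ℝ} (h : IsPrimitiveOn G g (Ioc a b)) : ContinuousOn G (Ioc a b) := by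
  intro x hx
  obtain ⟨c, hc, hcx⟩ := exists_between hx.1
  have h1 : ContinuousOn G (Icc c b) :=
    (h.mono fun y hy => ⟨hc.trans_le hy.1, hy.2⟩).continuousOn_Icc
  refine (h1 x ⟨hcx.le, hx.2⟩).mono_of_mem_nhdsWithin ?_
  filter_upwards [inter_mem_nhdsWithin (Ioc a b) (Ioi_mem_nhds hcx)] with y hy
  exact ⟨(mem_Ioi.1 hy.2).le, hy.1.2⟩

lemma continuousOn_Ioo {a b : ℝ} (h : IsPrimitiveOn G g (Ioo a b)) : ContinuousOn G (Ioo a b) := by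
  intro x hx
  obtain ⟨c, hxc, hc⟩ := exists_between hx.2
  have h1 : ContinuousOn G (Ioc a c) :=
    (h.mono fun y hy => ⟨hy.1, hy.2.trans_lt hc⟩).continuousOn_Ioc
  refine (h1 x ⟨hx.1, hxc.le⟩).mono_of_mem_nhdsWithin ?_
  filter_upwards [inter_mem_nhdsWithin (Ioo a b) (Iio_mem_nhds hxc)] with y hy
  exact ⟨hy.1.1, (mem_Iio.1 hy.2).le⟩

/-- The product rule. -/
lemma mul [hs : s.OrdConnected] (h : IsPrimitiveOn F f s) (h' : IsPrimitiveOn G g s) :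
    IsPrimitiveOn (fun x => F x * G x) (fun x => f x * G x + F x * g x) s := by
  intro x hx y hy
  have hF := h.absolutelyContinuous hx hy
  have hG := h'.absolutelyContinuous hx hy
  have i1 : IntervalIntegrable (fun x => f x * G x + F x * g x) volume x y :=
    ((h x hx y hy).1.mul_continuousOn hG.continuousOn).add
      ((h' x hx y hy).1.continuousOn_mul hF.continuousOn)
  refine ⟨i1, ?_⟩
  -- Lebesgue differentiation. The end points are discarded because the integral formula for `F` is
  -- needed on a whole neighbourhood of `z`.
  have key : ∀ {F f : ℝ → ℝ}, IsPrimitiveOn F f s →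
      ∀ᵐ z, z ∈ uIoc x y → deriv F z = f z := by
    intro F f h
    have e0 : ∀ᵐ z : ℝ, z ≠ x := (countable_singleton x).ae_notMem volume
    have e1 : ∀ᵐ z : ℝ, z ≠ y := (countable_singleton y).ae_notMem volume
    filter_upwards [(h x hx y hy).1.ae_hasDerivAt_integral, e0, e1] with z hz n0 n1 hzm
    have hz2 := hz (uIoc_subset_uIcc hzm) x left_mem_uIcc
    have hd : HasDerivAt (fun w => (∫ t in x..w, f t) + F x) (f z) z := hz2.add_const _
    refine (hd.congr_of_eventuallyEq ?_).deriv
    have hmem : Ioo (min x y) (max x y) ∈ 𝓝 z := by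
      refine Ioo_mem_nhds hzm.1 (lt_of_le_of_ne hzm.2 ?_)
      rcases max_choice x y with hm | hm <;> rw [hm] <;> assumption
    filter_upwards [hmem] with w hw
    rw [(h x hx w (hs.uIcc_subset hx hy (Ioo_subset_Icc_self hw))).2]
    ring
  rw [← hF.integral_deriv_mul_eq_sub hG]
  refine intervalIntegral.integral_congr_ae ?_
  filter_upwards [key h, key h'] with z h1 h2 hz
  rw [h1 hz, h2 hz]

/-- Passage to the limit at the left end point. -/
lemma integral_eq_of_tendsto {a b l : ℝ} (hab : a < b) (h : IsPrimitiveOn G g (Ioc a b))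
    (hg : IntervalIntegrable g volume a b) (hl : Tendsto G (𝓝[>] a) (𝓝 l)) :
    ∫ t in a..b, g t = G b - l := by
  have hc := intervalIntegral.continuousOn_primitive_interval_left
    ((uIcc_of_le hab.le).symm ▸ (intervalIntegrable_iff_integrableOn_Icc_of_le hab.le).1 hg)
  rw [uIcc_of_le hab.le] at hc
  have h1 : Tendsto (fun x => ∫ t in x..b, g t) (𝓝[>] a) (𝓝 (∫ t in a..b, g t)) := by
    have := hc a (left_mem_Icc.2 hab.le)
    refine this.mono_left ?_
    rw [← nhdsWithin_Ioc_eq_nhdsGT hab]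
    exact nhdsWithin_mono _ Ioc_subset_Icc_self
  refine tendsto_nhds_unique h1 ?_
  refine (tendsto_const_nhds.sub hl).congr' ?_
  filter_upwards [Ioc_mem_nhdsGT hab] with x hx
  rw [(h x hx b ⟨hab, le_rfl⟩).2]

end IsPrimitiveOn

lemma isPrimitiveOn_integral {g : ℝ → ℝ} {s : Set ℝ} {c k : ℝ}
    (hg : ∀ x ∈ s, IntervalIntegrable g volume c x) :
    IsPrimitiveOn (fun x => k + ∫ t in c..x, g t) g s := by
  intro x hx y hy
  refine ⟨(hg x hx).symm.trans (hg y hy), ?_⟩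
  rw [← intervalIntegral.integral_interval_sub_left (hg y hy) (hg x hx)]
  ring

/-! ### Weak derivatives -/

lemma IsCompact.subset_Icc_of_subset_Ioo {K : Set ℝ} (hK : IsCompact K) (h : K ⊆ Ioo 0 1) :
    ∃ α β : ℝ, 0 < α ∧ α ≤ β ∧ β < 1 ∧ K ⊆ Icc α β := by
  rcases K.eq_empty_or_nonempty with rfl | hne
  · exact ⟨1 / 2, 1 / 2, by norm_num, le_rfl, by norm_num, empty_subset _⟩
  · obtain ⟨α, hα⟩ := hK.exists_isLeast hne
    obtain ⟨β, hβ⟩ := hK.exists_isGreatest hne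
    exact ⟨α, β, (h hα.1).1, hα.2 hβ.1, (h hβ.1).2, fun x hx => ⟨hα.2 hx, hβ.2 hx⟩⟩

lemma intervalIntegrable_of_locallyIntegrableOn {g : ℝ → ℝ}
    (hg : LocallyIntegrableOn g (Ioo 0 1)) {x y : ℝ} (hx : x ∈ Ioo (0 : ℝ) 1)
    (hy : y ∈ Ioo (0 : ℝ) 1) : IntervalIntegrable g volume x y := by
  have h1 : IntegrableOn g (uIcc x y) :=
    hg.integrableOn_compact_subset (ordConnected_Ioo.uIcc_subset hx hy) isCompact_uIcc
  exact h1.intervalIntegrable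

lemma IsPrimitiveOn.locallyIntegrableOn {G g : ℝ → ℝ} (h : IsPrimitiveOn G g (Ioo 0 1)) :
    LocallyIntegrableOn g (Ioo 0 1) := by
  intro x hx
  have h1 := h.intervalIntegrable (x := x / 2) (y := (x + 1) / 2)
    ⟨by linarith [hx.1], by linarith [hx.2]⟩ ⟨by linarith [hx.1], by linarith [hx.2]⟩
  rw [intervalIntegrable_iff_integrableOn_Ioo_of_le (by linarith [hx.1, hx.2])] at h1
  exact ⟨_, mem_nhdsWithin_of_mem_nhds
    (Ioo_mem_nhds (by linarith [hx.1, hx.2]) (by linarith [hx.1, hx.2])), h1⟩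

lemma HasWeakDeriv.congr_left {f f' g : ℝ → ℝ} (h : HasWeakDeriv f g) (hf : f =ᵐ[unitVol] f') :
    HasWeakDeriv f' g := by
  refine ⟨h.1.congr hf, h.2.1, fun φ hφ hc hs => ?_⟩
  rw [← h.2.2 φ hφ hc hs]
  refine integral_congr_ae ?_
  filter_upwards [hf] with x hx
  rw [hx]

lemma setIntegral_Ioo_eq_of_support {f : ℝ → ℝ} {α β : ℝ} (h0 : 0 < α) (hab : α ≤ β) (h1 : β < 1)
    (hf : ∀ x, x ∉ Icc α β → f x = 0) : ∫ x in Ioo (0 : ℝ) 1, f x = ∫ x in α..β, f x := by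
  rw [intervalIntegral.integral_of_le hab, ← integral_Icc_eq_integral_Ioc]
  refine (setIntegral_eq_of_subset_of_forall_sdiff_eq_zero measurableSet_Ioo
    (fun x hx => ⟨h0.trans_le hx.1, hx.2.trans_lt h1⟩) fun x hx => hf x hx.2)

lemma IsPrimitiveOn.hasWeakDeriv {G g : ℝ → ℝ} (h : IsPrimitiveOn G g (Ioo 0 1)) :
    HasWeakDeriv G g := by
  refine ⟨h.continuousOn_Ioo.locallyIntegrableOn measurableSet_Ioo, h.locallyIntegrableOn,
    fun φ hφ hc hs => ?_⟩
  obtain ⟨α', β', hα', hαβ', hβ', hsub⟩ := IsCompact.subset_Icc_of_subset_Ioo hc hs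
  -- The interval is slightly enlarged so that `φ` vanishes at both of its ends and the product rule
  -- has no boundary terms.
  obtain ⟨α, hα, hα2⟩ := exists_between hα'
  obtain ⟨β, hβ2, hβ⟩ := exists_between hβ'
  have hz : ∀ x, x ∉ Icc α' β' → φ x = 0 := fun x hx => image_eq_zero_of_notMem_tsupport
    fun hx' => hx (hsub hx')
  have hdz : ∀ x, x ∉ Icc α' β' → deriv φ x = 0 := fun x hx => image_eq_zero_of_notMem_tsupport
    fun hx' => hx (hsub (closure_minimal support_deriv_subset (isClosed_tsupport φ) hx'))
  have hab : α ≤ β := by linarith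
  have hin : ∀ x, x ∉ Icc α β → x ∉ Icc α' β' :=
    fun x hx hx' => hx ⟨hα2.le.trans hx'.1, hx'.2.trans hβ2.le⟩
  have hφp : IsPrimitiveOn φ (deriv φ) (Ioo 0 1) :=
    IsPrimitiveOn.of_hasDerivAt (fun x => (hφ.differentiable (by simp) x).hasDerivAt)
      (hφ.continuous_deriv (by simp))
  have mα : α ∈ Ioo (0 : ℝ) 1 := ⟨hα, by linarith⟩
  have mβ : β ∈ Ioo (0 : ℝ) 1 := ⟨by linarith, hβ⟩
  have key := (h.mul hφp).integral_eq mα mβ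
  have cont := h.continuousOn_uIcc mα mβ
  have i1 : IntervalIntegrable (fun x => g x * φ x) volume α β :=
    (h.intervalIntegrable mα mβ).mul_continuousOn hφ.continuous.continuousOn
  have i2 : IntervalIntegrable (fun x => G x * deriv φ x) volume α β :=
    ((hφ.continuous_deriv (by simp)).intervalIntegrable _ _).continuousOn_mul cont
  rw [intervalIntegral.integral_add i1 i2, hz α (fun h => by linarith [h.1]),
    hz β (fun h => by linarith [h.2])] at key
  rw [setIntegral_Ioo_eq_of_support hα hab hβ (fun x hx => by rw [hdz x (hin x hx), mul_zero]),
    setIntegral_Ioo_eq_of_support hα hab hβ (fun x hx => by rw [hz x (hin x hx), mul_zero])]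
  linarith

/-- The du Bois-Reymond lemma: a function with vanishing weak derivative is constant. -/
lemma HasWeakDeriv.ae_eq_const {h : ℝ → ℝ} (hw : HasWeakDeriv h (fun _ => 0)) :
    ∃ c : ℝ, h =ᵐ[unitVol] fun _ => c := by
  let B : ContDiffBump (1 / 2 : ℝ) := ⟨1 / 8, 1 / 4, by norm_num, by norm_num⟩
  set φ₀ : ℝ → ℝ := B.normed volume with hφ₀
  have hφ₀s : ContDiff ℝ ∞ φ₀ := B.contDiff_normed
  have hφ₀c : HasCompactSupport φ₀ := B.hasCompactSupport_normed
  have hφ₀t : tsupport φ₀ ⊆ Ioo 0 1 := by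
    rw [hφ₀, B.tsupport_normed_eq, Real.closedBall_eq_Icc]
    intro x hx
    have h1 : (1 / 2 - 1 / 4 : ℝ) ≤ x := hx.1
    have h2 : x ≤ (1 / 2 + 1 / 4 : ℝ) := hx.2
    exact ⟨by linarith, by linarith⟩
  have hφ₀i : ∫ x, φ₀ x = 1 := B.integral_normed
  set c := ∫ x in Ioo (0 : ℝ) 1, h x * φ₀ x with hc
  refine ⟨c, ?_⟩
  have hloc : LocallyIntegrableOn (fun x => h x + -c) (Ioo 0 1) :=
    hw.1.add (locallyIntegrableOn_const _)
  have main := isOpen_Ioo.ae_eq_zero_of_integral_contDiff_smul_eq_zero (μ := volume) hloc ?_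
  · rw [EventuallyEq, ae_restrict_iff' measurableSet_Ioo]
    filter_upwards [main] with x hx hx2
    linarith [hx hx2]
  intro ψ hψ hψc hψt
  set m := ∫ x, ψ x with hm
  -- Subtracting the mass of `ψ`, carried by the normalised bump, leaves integral zero. The
  -- primitive `χ` of `η` then has compact support in `(0,1)` and is an admissible test function.
  set η : ℝ → ℝ := fun x => ψ x - m * φ₀ x with hη
  have hηs : ContDiff ℝ ∞ η := hψ.sub (contDiff_const.mul hφ₀s)
  obtain ⟨α, β, hα, hαβ, hβ, hsub⟩ := IsCompact.subset_Icc_of_subset_Ioo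
    (hψc.union hφ₀c) (union_subset hψt hφ₀t)
  have hψz : ∀ x, x ∉ Icc α β → ψ x = 0 := fun x hx => image_eq_zero_of_notMem_tsupport
    fun hx' => hx (hsub (Or.inl hx'))
  have hφz : ∀ x, x ∉ Icc α β → φ₀ x = 0 := fun x hx => image_eq_zero_of_notMem_tsupport
    fun hx' => hx (hsub (Or.inr hx'))
  have hηz : ∀ x, x ∉ Icc α β → η x = 0 := fun x hx => by simp [hη, hψz x hx, hφz x hx]
  have tot : ∀ {f : ℝ → ℝ}, (∀ x, x ∉ Icc α β → f x = 0) → ∫ x in α..β, f x = ∫ x, f x := by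
    intro f hf
    rw [intervalIntegral.integral_of_le hαβ, ← integral_Icc_eq_integral_Ioc]
    exact setIntegral_eq_integral_of_forall_compl_eq_zero hf
  have hηtot : ∫ x in α..β, η x = 0 := by
    rw [intervalIntegral.integral_sub (g := fun x => m * φ₀ x)
      (hψ.continuous.intervalIntegrable _ _) ((continuous_const.mul hφ₀s.continuous).intervalIntegrable _ _),
      intervalIntegral.integral_const_mul, tot hψz, tot hφz, hφ₀i]
    simp [hm]
  set χ : ℝ → ℝ := fun x => ∫ t in α..x, η t with hχ
  have hχd : ∀ x, HasDerivAt χ (η x) x := fun x =>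
    (hηs.continuous.integral_hasStrictDerivAt α x).hasDerivAt
  have hχdd : deriv χ = η := funext fun x => (hχd x).deriv
  have hχs : ContDiff ℝ ∞ χ := by
    rw [contDiff_infty_iff_deriv, hχdd]
    exact ⟨fun x => (hχd x).differentiableAt, hηs⟩
  have hχz : ∀ x, x ∉ Icc α β → χ x = 0 := by
    intro x hx
    rw [mem_Icc, not_and_or, not_le, not_le] at hx
    rcases hx with hx | hx
    · refine (intervalIntegral.integral_congr_ae (g := fun _ => 0)
        ?_).trans (by simp)
      filter_upwards [(countable_singleton α).ae_notMem volume] with z hne hz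
      rw [uIoc_of_ge hx.le] at hz
      exact hηz z fun hz' => hne (le_antisymm hz.2 hz'.1)
    · have e1 : χ x = (∫ t in α..β, η t) + ∫ t in β..x, η t :=
        (intervalIntegral.integral_add_adjacent_intervals (hηs.continuous.intervalIntegrable _ _)
          (hηs.continuous.intervalIntegrable _ _)).symm
      rw [e1, hηtot, zero_add]
      refine (intervalIntegral.integral_congr_ae (g := fun _ => 0)
        (Eventually.of_forall fun z hz => ?_)).trans (by simp)
      rw [uIoc_of_le hx.le] at hz
      exact hηz z fun hz' => absurd hz.1 (not_lt.2 hz'.2)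
  have hχt : tsupport χ ⊆ Icc α β :=
    closure_minimal (fun x hx => by_contra fun hx' => hx (hχz x hx')) isClosed_Icc
  have hχc : HasCompactSupport χ := isCompact_Icc.of_isClosed_subset (isClosed_tsupport χ) hχt
  have hIcc : Icc α β ⊆ Ioo 0 1 := fun x hx => ⟨hα.trans_le hx.1, hx.2.trans_lt hβ⟩
  have key := hw.2.2 χ hχs hχc (hχt.trans hIcc)
  simp only [zero_mul, integral_zero, neg_zero, hχdd, hη, mul_sub] at key
  have j1 := integrable_mul_test hw.1 hψ.continuous hψc hψt
  have j2 := integrable_mul_test hw.1 hφ₀s.continuous hφ₀c hφ₀t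
  have e2 : ∀ x, h x * (m * φ₀ x) = m * (h x * φ₀ x) := fun x => by ring
  simp only [e2] at key
  rw [integral_sub j1 (j2.const_mul m), integral_const_mul, ← hc] at key
  have e3 : ∫ x, ψ x • (h x + -c) = ∫ x in Ioo (0 : ℝ) 1, (h x * ψ x - c * ψ x) := by
    rw [← setIntegral_eq_integral_of_forall_compl_eq_zero (s := Ioo 0 1)]
    · refine integral_congr_ae (Eventually.of_forall fun x => ?_)
      simp only [smul_eq_mul]
      ring
    · intro x hx
      rw [hψz x fun hx' => hx (hIcc hx'), zero_smul]
  have hψi : Integrable ψ := hψ.continuous.integrable_of_hasCompactSupport hψc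
  rw [e3, integral_sub j1 (hψi.restrict.const_mul c), integral_const_mul,
    setIntegral_eq_integral_of_forall_compl_eq_zero (s := Ioo 0 1)
      (fun x hx => hψz x fun hx' => hx (hIcc hx')), ← hm]
  linarith

/-- The difference between `f` and the integral of `g` has weak derivative zero, hence is constant.
The base point `1/2` is interior because `g` is only locally integrable on the open interval. -/
lemma HasWeakDeriv.exists_isPrimitiveOn {f g : ℝ → ℝ} (h : HasWeakDeriv f g) :
    ∃ G, IsPrimitiveOn G g (Ioo 0 1) ∧ f =ᵐ[unitVol] G := by
  have h2 : (1 / 2 : ℝ) ∈ Ioo (0 : ℝ) 1 := by norm_num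
  have h1 : IsPrimitiveOn (fun x => 0 + ∫ t in (1 / 2 : ℝ)..x, g t) g (Ioo 0 1) :=
    isPrimitiveOn_integral fun x hx => intervalIntegrable_of_locallyIntegrableOn h.2.1 h2 hx
  have h3 := h.add (h1.hasWeakDeriv.const_mul (-1))
  have h4 : HasWeakDeriv _ (fun _ => (0 : ℝ)) :=
    h3.congr_right (Eventually.of_forall fun x => by simp)
  obtain ⟨c, hc⟩ := h4.ae_eq_const
  refine ⟨fun x => c + ∫ t in (1 / 2 : ℝ)..x, g t, isPrimitiveOn_integral fun x hx =>
    intervalIntegrable_of_locallyIntegrableOn h.2.1 h2 hx, ?_⟩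
  filter_upwards [hc] with x hx
  linarith

/-- A function continuous on `[0,1]` with integrable weak derivative is a primitive. -/
lemma HasWeakDeriv.eq_integral {f g : ℝ → ℝ} (h : HasWeakDeriv f g) (hf : ContinuousOn f (Icc 0 1))
    (h0 : f 0 = 0) (hg : IntervalIntegrable g volume 0 1) {x : ℝ} (hx : x ∈ Icc (0 : ℝ) 1) :
    f x = ∫ t in (0 : ℝ)..x, g t := by
  obtain ⟨G, hG, hfG⟩ := h.exists_isPrimitiveOn
  have e1 : EqOn f G (Ioo 0 1) := Measure.eqOn_open_of_ae_eq hfG isOpen_Ioo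
    (hf.mono Ioo_subset_Icc_self) hG.continuousOn_Ioo
  have h1 : IsPrimitiveOn f g (Ioo 0 1) := hG.congr_left e1
  have h2 : ∀ x ∈ Ioo (0 : ℝ) 1, f x = ∫ t in (0 : ℝ)..x, g t := by
    intro x hx
    have := (h1.mono (t := Ioc 0 x) fun y hy => ⟨hy.1, hy.2.trans_lt hx.2⟩).integral_eq_of_tendsto
      hx.1 (hg.mono_set (by
        rw [uIcc_of_le hx.1.le, uIcc_of_le zero_le_one]; exact Icc_subset_Icc_right hx.2.le))
      (l := 0) ?_
    · rw [this, sub_zero]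
    · have := hf 0 (by simp)
      rw [ContinuousWithinAt, h0] at this
      refine this.mono_left ?_
      rw [← nhdsWithin_Ioc_eq_nhdsGT (zero_lt_one' ℝ)]
      exact nhdsWithin_mono _ Ioc_subset_Icc_self
  have hc : ContinuousOn (fun x => ∫ t in (0 : ℝ)..x, g t) (Icc 0 1) :=
    ((isPrimitiveOn_integral (k := 0) (c := 0) (s := Icc 0 1) (g := g) fun x hx => hg.mono_set (by
      rw [uIcc_of_le hx.1, uIcc_of_le zero_le_one]
      exact Icc_subset_Icc_right hx.2)).continuousOn_Icc).congr fun x _ => by simp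
  have h3 : EqOn f (fun x => ∫ t in (0 : ℝ)..x, g t) (closure (Ioo 0 1)) := by
    refine EqOn.of_subset_closure (s := Ioo 0 1) h2 ?_ ?_ subset_closure subset_rfl
    · rwa [closure_Ioo (by norm_num)]
    · rwa [closure_Ioo (by norm_num)]
  rw [closure_Ioo (by norm_num)] at h3
  exact h3 hx

/-! ### The coefficient -/

/-- The common hypotheses of the weakly and the strongly degenerate case. -/
structure IsDegenerate (a : ℝ → ℝ) : Prop where
  contDiff : ContDiffOn ℝ 1 a (Ioc 0 1)
  pos : ∀ x ∈ Ioc (0 : ℝ) 1, 0 < a x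
  bdd : BddAbove ((fun x => x * |derivWithin a (Ioc 0 1) x| / a x) '' Ioc (0 : ℝ) 1)
  K_lt : degK a < 2

lemma WeaklyDegenerate.isDegenerate {a : ℝ → ℝ} (h : WeaklyDegenerate a) : IsDegenerate a :=
  ⟨h.contDiff, h.pos, h.bdd, h.K_mem.2.trans (by norm_num)⟩

lemma StronglyDegenerate.isDegenerate {a : ℝ → ℝ} (h : StronglyDegenerate a) : IsDegenerate a :=
  ⟨h.contDiff.mono Ioc_subset_Icc_self, h.pos, h.bdd, h.K_mem.2⟩

lemma setIntegral_Ioo_eq_intervalIntegral (f : ℝ → ℝ) :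
    ∫ x in Ioo (0 : ℝ) 1, f x = ∫ x in (0 : ℝ)..1, f x := by
  rw [intervalIntegral.integral_of_le zero_le_one, integral_Ioc_eq_integral_Ioo]

lemma intervalIntegrable_iff_unitVol {f : ℝ → ℝ} :
    IntervalIntegrable f volume 0 1 ↔ Integrable f unitVol :=
  intervalIntegrable_iff_integrableOn_Ioo_of_le zero_le_one

lemma sq_integral_mul_le {α : Type*} [MeasurableSpace α] {μ : Measure α} {f g : α → ℝ}
    (hf : MemLp f 2 μ) (hg : MemLp g 2 μ) :
    (∫ x, f x * g x ∂μ) ^ 2 ≤ (∫ x, f x ^ 2 ∂μ) * ∫ x, g x ^ 2 ∂μ := by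
  have key : ∀ {f g : α → ℝ} (hf : MemLp f 2 μ) (hg : MemLp g 2 μ),
      inner ℝ (hf.toLp f) (hg.toLp g) = ∫ x, f x * g x ∂μ := by
    intro f g hf hg
    rw [L2.inner_def]
    refine integral_congr_ae ?_
    filter_upwards [hf.coeFn_toLp, hg.coeFn_toLp] with x h1 h2
    simp [h1, h2, mul_comm]
  have := real_inner_mul_inner_self_le (hf.toLp f) (hg.toLp g)
  rw [key, key, key] at this
  simpa only [pow_two] using this

namespace IsDegenerate

lemma a_one_pos (h : IsDegenerate a) : 0 < a 1 := h.pos 1 ⟨one_pos, le_rfl⟩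

lemma deriv_bound (h : IsDegenerate a) {x : ℝ} (hx : x ∈ Ioc (0 : ℝ) 1) :
    x * |derivWithin a (Ioc 0 1) x| ≤ degK a * a x := by
  rw [← div_le_iff₀ (h.pos x hx)]
  exact le_csSup h.bdd (mem_image_of_mem _ hx)

lemma degK_nonneg (h : IsDegenerate a) : 0 ≤ degK a := by
  have h1 := h.deriv_bound (x := 1) ⟨one_pos, le_rfl⟩
  have h2 : 0 ≤ degK a * a 1 := le_trans (by positivity) h1
  exact nonneg_of_mul_nonneg_left h2 h.a_one_pos

lemma continuousOn (h : IsDegenerate a) : ContinuousOn a (Ioc 0 1) := h.contDiff.continuousOn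

lemma continuousOn_derivWithin (h : IsDegenerate a) :
    ContinuousOn (derivWithin a (Ioc 0 1)) (Ioc 0 1) :=
  h.contDiff.continuousOn_derivWithin (uniqueDiffOn_Ioc 0 1) le_rfl

lemma hasDerivAt (h : IsDegenerate a) {x : ℝ} (hx : x ∈ Ioo (0 : ℝ) 1) :
    HasDerivAt a (derivWithin a (Ioc 0 1) x) x :=
  (h.contDiff.differentiableOn one_ne_zero x (Ioo_subset_Ioc_self hx)).hasDerivWithinAt.hasDerivAt
    (Ioc_mem_nhds hx.1 hx.2)

/-- The derivative of `x² / a` has the sign of `x (2a - x a')`, which is nonnegative because `x |a'|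
≤ K a` and `K < 2`. This controls the singularity of `1/a` at `0` in all the weighted estimates. -/
lemma sq_div_le (h : IsDegenerate a) {x : ℝ} (hx : x ∈ Ioc (0 : ℝ) 1) :
    x ^ 2 / a x ≤ 1 / a 1 := by
  have hd : ∀ y ∈ Ioo (0 : ℝ) 1, HasDerivAt (fun y => y ^ 2 / a y)
      ((2 * y * a y - y ^ 2 * derivWithin a (Ioc 0 1) y) / a y ^ 2) y := by
    intro y hy
    have h1 := ((hasDerivAt_id y).pow 2).div (h.hasDerivAt hy) (h.pos y ⟨hy.1, hy.2.le⟩).ne'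
    refine h1.congr_deriv ?_
    simp
  have hm : MonotoneOn (fun y => y ^ 2 / a y) (Ioc 0 1) := by
    refine monotoneOn_of_deriv_nonneg (convex_Ioc 0 1)
      ((continuousOn_id.pow 2).div h.continuousOn fun y hy => (h.pos y hy).ne') ?_ ?_
    · rw [interior_Ioc]
      exact fun y hy => (hd y hy).differentiableAt.differentiableWithinAt
    · rw [interior_Ioc]
      intro y hy
      rw [(hd y hy).deriv]
      have h1 := h.deriv_bound (Ioo_subset_Ioc_self hy)
      have h2 : y * derivWithin a (Ioc 0 1) y ≤ 2 * a y := by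
        have h3 := h.pos y (Ioo_subset_Ioc_self hy)
        nlinarith [le_abs_self (derivWithin a (Ioc 0 1) y), hy.1, h.K_lt]
      refine div_nonneg ?_ (by positivity)
      nlinarith [hy.1]
  simpa using hm hx ⟨one_pos, le_rfl⟩ hx.2

lemma ae_pos (h : IsDegenerate a) : ∀ᵐ x ∂unitVol, 0 < a x := by
  filter_upwards [ae_restrict_mem measurableSet_Ioo] with x hx
  exact h.pos x (Ioo_subset_Ioc_self hx)

lemma aemeasurable_inv (h : IsDegenerate a) : AEMeasurable (fun x => 1 / a x) unitVol :=
  ContinuousOn.aemeasurable (continuousOn_const.div (h.continuousOn.mono Ioo_subset_Ioc_self)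
    fun x hx => (h.pos x (Ioo_subset_Ioc_self hx)).ne') measurableSet_Ioo

lemma ac (h : IsDegenerate a) : unitVol ≪ wMeasure a := by
  refine withDensity_absolutelyContinuous' h.aemeasurable_inv.ennreal_ofReal ?_
  filter_upwards [h.ae_pos] with x hx
  rw [Ne, ENNReal.ofReal_eq_zero, not_le]
  positivity

lemma ae_iff (h : IsDegenerate a) {P : ℝ → Prop} :
    (∀ᵐ x ∂wMeasure a, P x) ↔ ∀ᵐ x ∂unitVol, P x :=
  ⟨fun H => h.ac.ae_le H, fun H => (withDensity_absolutelyContinuous _ _).ae_le H⟩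

lemma integral_wMeasure (h : IsDegenerate a) (f : ℝ → ℝ) :
    ∫ x, f x ∂wMeasure a = ∫ x in Ioo (0 : ℝ) 1, f x / a x := by
  rw [integral_withDensity_eq_integral_toReal_smul₀ h.aemeasurable_inv.ennreal_ofReal (by simp)]
  refine integral_congr_ae ?_
  filter_upwards [h.ae_pos] with x hx
  rw [ENNReal.toReal_ofReal (by positivity), smul_eq_mul]
  ring

lemma integrable_wMeasure (h : IsDegenerate a) {f : ℝ → ℝ} :
    Integrable f (wMeasure a) ↔ Integrable (fun x => f x / a x) unitVol := by
  rw [wMeasure, integrable_withDensity_iff_integrable_smul₀' h.aemeasurable_inv.ennreal_ofReal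
    (by simp)]
  refine integrable_congr ?_
  filter_upwards [h.ae_pos] with x hx
  rw [ENNReal.toReal_ofReal (by positivity), smul_eq_mul]
  ring

lemma inner_eq (h : IsDegenerate a) (v w : L2w a) :
    inner ℝ v w = ∫ x in Ioo (0 : ℝ) 1, v x * w x / a x := by
  rw [L2.inner_def, ← h.integral_wMeasure]
  simp [mul_comm]

lemma norm_sq_eq (h : IsDegenerate a) (v : L2w a) :
    ‖v‖ ^ 2 = ∫ x in Ioo (0 : ℝ) 1, v x ^ 2 / a x := by
  rw [← real_inner_self_eq_norm_sq, h.inner_eq]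
  simp only [pow_two]

lemma integrable_mul (h : IsDegenerate a) (v w : L2w a) :
    Integrable (fun x => v x * w x / a x) unitVol :=
  h.integrable_wMeasure.1 ((Lp.memLp v).integrable_mul (Lp.memLp w))

lemma sq_div_le_of_bound (h : IsDegenerate a) {g C x : ℝ} (hx : x ∈ Ioc (0 : ℝ) 1)
    (hg : |g| ≤ C * x) : g ^ 2 / a x ≤ C ^ 2 * (1 / a 1) := by
  have h1 := h.sq_div_le hx
  have h2 : g ^ 2 ≤ (C * x) ^ 2 := by
    rw [← sq_abs g]
    exact pow_le_pow_left₀ (abs_nonneg _) hg 2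
  have h3 := h.pos x hx
  calc g ^ 2 / a x ≤ (C * x) ^ 2 / a x := by gcongr
    _ = C ^ 2 * (x ^ 2 / a x) := by ring
    _ ≤ _ := by gcongr

/-- A function that is `O(x)` belongs to `L²_{1/a}`. -/
lemma memLp_of_bound (h : IsDegenerate a) {g : ℝ → ℝ} {C : ℝ} (hg : AEStronglyMeasurable g unitVol)
    (hb : ∀ x ∈ Ioo (0 : ℝ) 1, |g x| ≤ C * x) : MemLp g 2 (wMeasure a) := by
  rw [memLp_two_iff_integrable_sq (hg.mono_ac (withDensity_absolutelyContinuous _ _)),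
    h.integrable_wMeasure]
  refine Integrable.of_bound (C := C ^ 2 * (1 / a 1)) ?_ ?_
  · simp only [div_eq_mul_one_div (_ ^ 2) (a _)]
    exact (hg.pow 2).mul h.aemeasurable_inv.aestronglyMeasurable
  · filter_upwards [ae_restrict_mem measurableSet_Ioo] with x hx
    have h3 := h.pos x (Ioo_subset_Ioc_self hx)
    rw [Real.norm_of_nonneg (by positivity)]
    exact h.sq_div_le_of_bound (Ioo_subset_Ioc_self hx) (hb x hx)

lemma norm_le_of_bound (h : IsDegenerate a) {g : ℝ → ℝ} {C : ℝ} (hC : 0 ≤ C) (v : L2w a)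
    (hg : v =ᵐ[unitVol] g) (hb : ∀ x ∈ Ioo (0 : ℝ) 1, |g x| ≤ C * x) :
    ‖v‖ ≤ √(1 / a 1) * C := by
  have h1 := h.a_one_pos
  refine abs_le_of_sq_le_sq' ?_ (by positivity) |>.2
  rw [h.norm_sq_eq, mul_pow, Real.sq_sqrt (by positivity), mul_comm]
  have h2 : ∫ x in Ioo (0 : ℝ) 1, v x ^ 2 / a x ≤ ∫ x in Ioo (0 : ℝ) 1, C ^ 2 * (1 / a 1) := by
    refine integral_mono_ae ?_ (integrable_const _) ?_
    · simpa only [pow_two] using h.integrable_mul v v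
    · filter_upwards [ae_restrict_mem measurableSet_Ioo, hg] with x hx hgx
      rw [hgx]
      exact h.sq_div_le_of_bound (Ioo_subset_Ioc_self hx) (hb x hx)
  simpa using h2

end IsDegenerate

/-! ### Iterated primitives -/

/-- The primitive of `p` vanishing at `0`. -/
def prim (p : ℝ → ℝ) (x : ℝ) : ℝ := ∫ t in (0 : ℝ)..x, p t

@[simp] lemma prim_zero (p : ℝ → ℝ) : prim p 0 = 0 := by simp [prim]

lemma intervalIntegrable_of_unitVol {p : ℝ → ℝ} (hp : Integrable p unitVol) {x y : ℝ}
    (hx : x ∈ Icc (0 : ℝ) 1) (hy : y ∈ Icc (0 : ℝ) 1) : IntervalIntegrable p volume x y :=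
  (intervalIntegrable_iff_unitVol.2 hp).mono_set (by
    rw [uIcc_of_le (zero_le_one' ℝ)]
    exact ordConnected_Icc.uIcc_subset hx hy)

lemma isPrimitiveOn_prim {p : ℝ → ℝ} (hp : Integrable p unitVol) :
    IsPrimitiveOn (prim p) p (Icc 0 1) := by
  have := isPrimitiveOn_integral (g := p) (s := Icc 0 1) (c := 0) (k := 0)
    fun x hx => intervalIntegrable_of_unitVol hp (by simp) hx
  simp only [zero_add] at this
  exact this

lemma integrable_of_continuousOn {f : ℝ → ℝ} (hf : ContinuousOn f (Icc 0 1)) :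
    Integrable f unitVol :=
  (hf.integrableOn_Icc).mono_set Ioo_subset_Icc_self

lemma integrable_prim {p : ℝ → ℝ} (hp : Integrable p unitVol) : Integrable (prim p) unitVol :=
  integrable_of_continuousOn (isPrimitiveOn_prim hp).continuousOn_Icc

lemma isPrimitiveOn_prim_prim {p : ℝ → ℝ} (hp : Integrable p unitVol) :
    IsPrimitiveOn (prim (prim p)) (prim p) (Icc 0 1) :=
  isPrimitiveOn_prim (integrable_prim hp)

lemma prim_eq_of_isPrimitiveOn {F f : ℝ → ℝ} (h : IsPrimitiveOn F f (Icc 0 1)) (h0 : F 0 = 0)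
    {x : ℝ} (hx : x ∈ Icc (0 : ℝ) 1) : prim f x = F x := by
  rw [prim, h.integral_eq (by simp) hx, h0, sub_zero]

lemma prim_congr_ae {p q : ℝ → ℝ} (hpq : p =ᵐ[unitVol] q) {x : ℝ} (hx : x ∈ Icc (0 : ℝ) 1) :
    prim p x = prim q x := by
  refine intervalIntegral.integral_congr_ae ?_
  rw [EventuallyEq, ae_restrict_iff' measurableSet_Ioo] at hpq
  filter_upwards [hpq, (countable_singleton (1 : ℝ)).ae_notMem volume] with z hz h1 hzm
  rw [uIoc_of_le hx.1] at hzm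
  exact hz ⟨hzm.1, lt_of_le_of_ne (hzm.2.trans hx.2) h1⟩

lemma prim_congr {p q : ℝ → ℝ} (hpq : EqOn p q (Icc 0 1)) {x : ℝ} (hx : x ∈ Icc (0 : ℝ) 1) :
    prim p x = prim q x := by
  refine prim_congr_ae ?_ hx
  filter_upwards [ae_restrict_mem measurableSet_Ioo] with z hz
  exact hpq (Ioo_subset_Icc_self hz)

lemma prim_add {p q : ℝ → ℝ} (hp : Integrable p unitVol) (hq : Integrable q unitVol) {x : ℝ}
    (hx : x ∈ Icc (0 : ℝ) 1) : prim (fun t => p t + q t) x = prim p x + prim q x :=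
  intervalIntegral.integral_add (intervalIntegrable_of_unitVol hp (by simp) hx)
    (intervalIntegrable_of_unitVol hq (by simp) hx)

lemma prim_const_mul (c : ℝ) (p : ℝ → ℝ) (x : ℝ) : prim (fun t => c * p t) x = c * prim p x :=
  intervalIntegral.integral_const_mul _ _

lemma L2.integrable (p : L2) : Integrable p unitVol := (Lp.memLp p).integrable one_le_two

lemma L2.inner_eq (p q : L2) : inner ℝ p q = ∫ x in Ioo (0 : ℝ) 1, p x * q x := by
  rw [MeasureTheory.L2.inner_def]
  simp [mul_comm]

lemma L2.norm_sq_eq (p : L2) : ‖p‖ ^ 2 = ∫ x in Ioo (0 : ℝ) 1, p x ^ 2 := by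
  rw [← real_inner_self_eq_norm_sq, L2.inner_eq]
  simp only [pow_two]

/-- Cauchy–Schwarz against the constant `1`. It serves both for the decay of `u'` at `0` and for
equicontinuity in the compactness argument. -/
lemma abs_prim_sub_le (p : L2) {x y : ℝ} (hx : 0 ≤ x) (hxy : x ≤ y) (hy : y ≤ 1) :
    |prim p y - prim p x| ≤ √(y - x) * ‖p‖ := by
  refine abs_le_of_sq_le_sq ?_ (by positivity)
  rw [mul_pow, Real.sq_sqrt (by linarith), ← (isPrimitiveOn_prim (L2.integrable p)).integral_eq
    ⟨hx, hxy.trans hy⟩ ⟨hx.trans hxy, hy⟩, L2.norm_sq_eq]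
  have hsub : Ioo x y ⊆ Ioo 0 1 := Ioo_subset_Ioo hx hy
  have hm : MemLp p 2 (volume.restrict (Ioo x y)) :=
    (Lp.memLp p).mono_measure (Measure.restrict_mono hsub le_rfl)
  have h1 := sq_integral_mul_le (memLp_const (1 : ℝ)) hm
  rw [intervalIntegral.integral_of_le hxy, integral_Ioc_eq_integral_Ioo]
  simp only [one_mul, one_pow, integral_const, smul_eq_mul, mul_one] at h1
  have h2 : (volume.restrict (Ioo x y)).real univ = y - x := by
    simp [hxy]
  rw [h2] at h1
  refine h1.trans (mul_le_mul_of_nonneg_left ?_ (by linarith))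
  exact setIntegral_mono_set (Lp.memLp p).integrable_sq (Eventually.of_forall fun _ => sq_nonneg _)
    (LE.le.eventuallyLE hsub)

lemma abs_prim_le (p : L2) {x : ℝ} (hx : x ∈ Icc (0 : ℝ) 1) : |prim p x| ≤ √x * ‖p‖ := by
  simpa using abs_prim_sub_le p le_rfl hx.1 hx.2

/-- The decay `x^(3/2)` is more than membership in `L²_{1/a}` requires; the extra half power
compensates `u''' = O(x^(-1/2))` in Green's formula. -/
lemma abs_prim_prim_le (p : L2) {x : ℝ} (hx : x ∈ Icc (0 : ℝ) 1) :
    |prim (prim p) x| ≤ √x * ‖p‖ * x := by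
  have := intervalIntegral.norm_integral_le_of_norm_le_const (a := 0) (b := x) (f := prim p)
    (C := √x * ‖p‖) ?_
  · rw [sub_zero, abs_of_nonneg hx.1] at this
    exact this
  · intro t ht
    rw [uIoc_of_le hx.1] at ht
    refine (abs_prim_le p ⟨ht.1.le, ht.2.trans hx.2⟩).trans ?_
    gcongr
    exact ht.2

lemma sqrt_mul_le {x c : ℝ} (hx : x ∈ Icc (0 : ℝ) 1) (hc : 0 ≤ c) : √x * c ≤ c :=
  mul_le_of_le_one_left hc (Real.sqrt_le_one.2 hx.2)

/-- A linear operator on `L²(0,1)` with values `O(x)`, as a bounded operator to `L²_{1/a}(0,1)`. -/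
def mkOp (h : IsDegenerate a) (Φ : (ℝ → ℝ) → ℝ → ℝ)
    (hm : ∀ p : L2, ContinuousOn (Φ p) (Icc 0 1))
    (hadd : ∀ p q : L2, ∀ x ∈ Ioo (0 : ℝ) 1, Φ (p + q : L2) x = Φ p x + Φ q x)
    (hsmul : ∀ (c : ℝ) (p : L2), ∀ x ∈ Ioo (0 : ℝ) 1, Φ (c • p : L2) x = c * Φ p x)
    (hb : ∀ p : L2, ∀ x ∈ Ioo (0 : ℝ) 1, |Φ p x| ≤ ‖p‖ * x) : L2 →L[ℝ] L2w a :=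
  have hM : ∀ p : L2, MemLp (Φ p) 2 (wMeasure a) := fun p =>
    h.memLp_of_bound (integrable_of_continuousOn (hm p)).aestronglyMeasurable (hb p)
  LinearMap.mkContinuous
    { toFun := fun p => (hM p).toLp
      map_add' := fun p q => by
        refine Lp.ext ?_
        have e : ∀ᵐ x ∂wMeasure a, x ∈ Ioo (0 : ℝ) 1 :=
          h.ae_iff.2 (ae_restrict_mem measurableSet_Ioo)
        filter_upwards [(hM (p + q)).coeFn_toLp, (hM p).coeFn_toLp, (hM q).coeFn_toLp,
          Lp.coeFn_add (hM p).toLp (hM q).toLp, e] with x h1 h2 h3 h4 h5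
        rw [h1, h4, Pi.add_apply, h2, h3, hadd p q x h5]
      map_smul' := fun c p => by
        refine Lp.ext ?_
        have e : ∀ᵐ x ∂wMeasure a, x ∈ Ioo (0 : ℝ) 1 :=
          h.ae_iff.2 (ae_restrict_mem measurableSet_Ioo)
        filter_upwards [(hM (c • p)).coeFn_toLp, (hM p).coeFn_toLp,
          Lp.coeFn_smul c (hM p).toLp, e] with x h1 h2 h4 h5
        rw [h1, RingHom.id_apply, h4, Pi.smul_apply, h2, hsmul c p x h5, smul_eq_mul] }
    (√(1 / a 1))
    fun p => h.norm_le_of_bound (norm_nonneg p) _ (h.ae_iff.1 (hM p).coeFn_toLp) (hb p)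

lemma mkOp_coe (h : IsDegenerate a) (Φ : (ℝ → ℝ) → ℝ → ℝ) (hm hadd hsmul hb) (p : L2) :
    mkOp h Φ hm hadd hsmul hb p =ᵐ[unitVol] Φ p :=
  h.ae_iff.1 (MemLp.coeFn_toLp (h.memLp_of_bound
    (integrable_of_continuousOn (hm p)).aestronglyMeasurable (hb p)))

lemma norm_mkOp_le (h : IsDegenerate a) (Φ : (ℝ → ℝ) → ℝ → ℝ) (hm hadd hsmul hb) (p : L2) :
    ‖mkOp h Φ hm hadd hsmul hb p‖ ≤ √(1 / a 1) * ‖p‖ :=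
  h.norm_le_of_bound (norm_nonneg p) _ (mkOp_coe h Φ hm hadd hsmul hb p) (hb p)

lemma prim_coe_add (p q : L2) {x : ℝ} (hx : x ∈ Icc (0 : ℝ) 1) :
    prim (p + q : L2) x = prim p x + prim q x := by
  rw [prim_congr_ae (Lp.coeFn_add p q) hx]
  exact prim_add (L2.integrable p) (L2.integrable q) hx

lemma prim_coe_smul (c : ℝ) (p : L2) {x : ℝ} (hx : x ∈ Icc (0 : ℝ) 1) :
    prim (c • p : L2) x = c * prim p x := by
  rw [prim_congr_ae (Lp.coeFn_smul c p) hx]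
  exact prim_const_mul c p x

/-- `p ↦ u`, where `u'' = p` and `u(0) = u'(0) = 0`. -/
def opJ (h : IsDegenerate a) : L2 →L[ℝ] L2w a :=
  mkOp h (fun p => prim (prim p))
    (fun p => (isPrimitiveOn_prim_prim (L2.integrable p)).continuousOn_Icc)
    (fun p q x hx => by
      rw [prim_congr (fun t ht => prim_coe_add p q ht) (Ioo_subset_Icc_self hx)]
      exact prim_add (integrable_prim (L2.integrable p)) (integrable_prim (L2.integrable q))
        (Ioo_subset_Icc_self hx))
    (fun c p x hx => by
      rw [prim_congr (fun t ht => prim_coe_smul c p ht) (Ioo_subset_Icc_self hx)]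
      exact prim_const_mul c _ x)
    (fun p x hx => (abs_prim_prim_le p (Ioo_subset_Icc_self hx)).trans
      (mul_le_mul_of_nonneg_right (sqrt_mul_le (Ioo_subset_Icc_self hx) (norm_nonneg p)) hx.1.le))

/-- `p ↦ x u_x`, where `u'' = p` and `u(0) = u'(0) = 0`. -/
def opN (h : IsDegenerate a) : L2 →L[ℝ] L2w a :=
  mkOp h (fun p x => x * prim p x)
    (fun p => continuousOn_id.mul (isPrimitiveOn_prim (L2.integrable p)).continuousOn_Icc)
    (fun p q x hx => by rw [prim_coe_add p q (Ioo_subset_Icc_self hx), mul_add])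
    (fun c p x hx => by rw [prim_coe_smul c p (Ioo_subset_Icc_self hx)]; ring)
    (fun p x hx => by
      rw [abs_mul, abs_of_pos hx.1, mul_comm]
      exact mul_le_mul_of_nonneg_right ((abs_prim_le p (Ioo_subset_Icc_self hx)).trans
        (sqrt_mul_le (Ioo_subset_Icc_self hx) (norm_nonneg p))) hx.1.le)

lemma opJ_coe (h : IsDegenerate a) (p : L2) : opJ h p =ᵐ[unitVol] prim (prim p) :=
  mkOp_coe h _ _ _ _ _ p

lemma opN_coe (h : IsDegenerate a) (p : L2) : opN h p =ᵐ[unitVol] fun x => x * prim p x :=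
  mkOp_coe h _ _ _ _ _ p

lemma norm_opJ_le (h : IsDegenerate a) (p : L2) : ‖opJ h p‖ ≤ √(1 / a 1) * ‖p‖ :=
  norm_mkOp_le h _ _ _ _ _ p

lemma norm_opN_le (h : IsDegenerate a) (p : L2) : ‖opN h p‖ ≤ √(1 / a 1) * ‖p‖ :=
  norm_mkOp_le h _ _ _ _ _ p

/-! ### Functions with prescribed fourth derivative -/

/-- The third derivative of a function with fourth derivative `w / a`. -/
def jet3 (w : L2w a) (c₃ x : ℝ) : ℝ := c₃ + ∫ t in (1 : ℝ)..x, w t / a t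

/-- The second derivative of a function with fourth derivative `w / a`. -/
def jet2 (w : L2w a) (c₃ c₂ x : ℝ) : ℝ := c₂ + ∫ t in (1 : ℝ)..x, jet3 w c₃ t

@[simp] lemma jet2_one (w : L2w a) (c₃ c₂ : ℝ) : jet2 w c₃ c₂ 1 = c₂ := by simp [jet2]

/-- Pairing `w` with this indicator in `L²_{1/a}` shows that `w / a` is integrable away from `0`.
Integrability up to `0` is not available, which is why the jets are integrated from `1`. -/
lemma memLp_indicator (h : IsDegenerate a) {x : ℝ} (hx : 0 < x) :
    MemLp ((Ioo x 1).indicator fun _ => (1 : ℝ)) 2 (wMeasure a) := by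
  refine h.memLp_of_bound (C := 1 / x)
    ((measurable_const.indicator measurableSet_Ioo).aestronglyMeasurable) fun y hy => ?_
  by_cases hm : y ∈ Ioo x 1
  · rw [indicator_of_mem hm, abs_one, div_mul_eq_mul_div, one_mul, le_div_iff₀ hx, one_mul]
    exact hm.1.le
  · rw [indicator_of_notMem hm, abs_zero]
    have := hy.1
    positivity

lemma integrableOn_div (h : IsDegenerate a) (w : L2w a) {x : ℝ} (hx : 0 < x) :
    IntegrableOn (fun t => w t / a t) (Ioo x 1) := by
  have h1 := h.integrable_wMeasure.1 ((memLp_indicator h hx).integrable_mul (Lp.memLp w))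
  have h2 : IntegrableOn (fun t => (Ioo x 1).indicator (fun _ => (1 : ℝ)) t * w t / a t)
      (Ioo x 1) := by
    have h3 : Ioo x 1 ⊆ Ioo 0 1 := Ioo_subset_Ioo_left hx.le
    exact h1.mono_measure (Measure.restrict_mono h3 le_rfl)
  refine h2.congr_fun (fun t ht => ?_) measurableSet_Ioo
  simp only [indicator_of_mem ht, one_mul]

lemma isPrimitiveOn_jet3 (h : IsDegenerate a) (w : L2w a) (c₃ : ℝ) :
    IsPrimitiveOn (jet3 w c₃) (fun t => w t / a t) (Ioc 0 1) :=
  isPrimitiveOn_integral fun _ hx => ((intervalIntegrable_iff_integrableOn_Ioo_of_le hx.2).2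
    (integrableOn_div h w hx.1)).symm

lemma isPrimitiveOn_jet2 (h : IsDegenerate a) (w : L2w a) (c₃ c₂ : ℝ) :
    IsPrimitiveOn (jet2 w c₃ c₂) (jet3 w c₃) (Ioc 0 1) := by
  refine isPrimitiveOn_integral fun x hx => ?_
  have h1 : uIcc 1 x ⊆ Ioc 0 1 := ordConnected_Ioc.uIcc_subset ⟨one_pos, le_rfl⟩ hx
  exact ((isPrimitiveOn_jet3 h w c₃).continuousOn_Ioc.mono h1).intervalIntegrable

lemma continuousOn_jet3 (h : IsDegenerate a) (w : L2w a) (c₃ : ℝ) :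
    ContinuousOn (jet3 w c₃) (Ioc 0 1) := (isPrimitiveOn_jet3 h w c₃).continuousOn_Ioc

lemma continuousOn_jet2 (h : IsDegenerate a) (w : L2w a) (c₃ c₂ : ℝ) :
    ContinuousOn (jet2 w c₃ c₂) (Ioc 0 1) := (isPrimitiveOn_jet2 h w c₃ c₂).continuousOn_Ioc

/-- Cauchy–Schwarz in `L²_{1/a}` against the indicator of `(x,1)`, whose squared norm is `∫ₓ¹ 1/a ≤
(1/a(1)) ∫ₓ¹ t⁻² dt ≤ 1/(a(1) x)`. -/
lemma abs_integral_div_le (h : IsDegenerate a) (w : L2w a) {x : ℝ} (hx : x ∈ Ioc (0 : ℝ) 1) :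
    |∫ t in x..1, w t / a t| ≤ √(1 / a 1) * ‖w‖ / √x := by
  have h1 := h.a_one_pos
  have hx0 := hx.1
  have hsub : Ioo x 1 ⊆ Ioo 0 1 := Ioo_subset_Ioo_left hx.1.le
  have cs := sq_integral_mul_le (memLp_indicator h hx.1) (Lp.memLp w)
  rw [h.integral_wMeasure, h.integral_wMeasure, h.integral_wMeasure, ← h.norm_sq_eq] at cs
  have ind : ∀ f : ℝ → ℝ, ∫ t in Ioo (0 : ℝ) 1, (Ioo x 1).indicator f t = ∫ t in x..1, f t := by
    intro f
    rw [setIntegral_indicator measurableSet_Ioo, inter_eq_right.2 hsub,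
      intervalIntegral.integral_of_le hx.2, integral_Ioc_eq_integral_Ioo]
  have e1 : ∀ t, (Ioo x 1).indicator (fun _ => (1 : ℝ)) t * w t / a t =
      (Ioo x 1).indicator (fun t => w t / a t) t := by
    intro t
    by_cases ht : t ∈ Ioo x 1 <;> simp [ht]
  have e2 : ∀ t, (Ioo x 1).indicator (fun _ => (1 : ℝ)) t ^ 2 / a t =
      (Ioo x 1).indicator (fun t => 1 / a t) t := by
    intro t
    by_cases ht : t ∈ Ioo x 1 <;> simp [ht]
  simp only [e1, e2, ind] at cs
  have hIcc : Icc x 1 ⊆ Ioc 0 1 := fun t ht => ⟨hx.1.trans_le ht.1, ht.2⟩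
  have c1 : ContinuousOn (fun t => 1 / a t) (Icc x 1) :=
    continuousOn_const.div (h.continuousOn.mono hIcc) fun t ht => (h.pos t (hIcc ht)).ne'
  have hd : ∀ t ∈ uIcc x 1, HasDerivAt (fun t => -(1 / a 1) * t⁻¹) (1 / a 1 / t ^ 2) t := by
    intro t ht
    rw [uIcc_of_le hx.2] at ht
    refine ((hasDerivAt_inv (hIcc ht).1.ne').const_mul (-(1 / a 1))).congr_deriv ?_
    ring
  have c2 : ContinuousOn (fun t => 1 / a 1 / t ^ 2) (Icc x 1) :=
    continuousOn_const.div (continuousOn_id.pow 2) fun t ht => (pow_pos (hIcc ht).1 2).ne'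
  have b1 : ∫ t in x..1, 1 / a t ≤ ∫ t in x..1, 1 / a 1 / t ^ 2 := by
    refine intervalIntegral.integral_mono_on hx.2 (c1.intervalIntegrable_of_Icc hx.2)
      (c2.intervalIntegrable_of_Icc hx.2) fun t ht => ?_
    have h2 := h.sq_div_le (hIcc ht)
    have h3 := h.pos t (hIcc ht)
    have h4 := (hIcc ht).1
    rw [le_div_iff₀ (by positivity)]
    calc 1 / a t * t ^ 2 = t ^ 2 / a t := by ring
      _ ≤ _ := h2
  rw [intervalIntegral.integral_eq_sub_of_hasDerivAt hd (c2.intervalIntegrable_of_Icc hx.2)] at b1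
  have b2 : ∫ t in x..1, 1 / a t ≤ 1 / a 1 / x := by
    refine b1.trans ?_
    have : 0 < 1 / a 1 := by positivity
    rw [inv_one]
    have e : 1 / a 1 / x = 1 / a 1 * x⁻¹ := by ring
    rw [e]
    linarith
  refine abs_le_of_sq_le_sq ?_ (by positivity)
  rw [div_pow, mul_pow, Real.sq_sqrt (by positivity), Real.sq_sqrt hx.1.le]
  calc _ ≤ _ := cs
    _ ≤ 1 / a 1 / x * ‖w‖ ^ 2 := by gcongr
    _ = _ := by ring

lemma exists_jet3_bound (h : IsDegenerate a) (w : L2w a) (c₃ : ℝ) :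
    ∃ C : ℝ, 0 ≤ C ∧ ∀ x ∈ Ioc (0 : ℝ) 1, |jet3 w c₃ x| ≤ C / √x := by
  refine ⟨|c₃| + √(1 / a 1) * ‖w‖, by positivity, fun x hx => ?_⟩
  have h1 := abs_integral_div_le h w hx
  have h2 : |c₃| ≤ |c₃| / √x := by
    rw [le_div_iff₀ (Real.sqrt_pos.2 hx.1), mul_comm]
    exact sqrt_mul_le ⟨hx.1.le, hx.2⟩ (abs_nonneg _)
  rw [jet3, intervalIntegral.integral_symm, add_div]
  refine (abs_add_le _ _).trans ?_
  rw [abs_neg]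
  exact add_le_add h2 h1

/-- The bound `C / √x` on the third derivative is integrable at `0`, with primitive `2C√x`. -/
lemma exists_jet2_bound (h : IsDegenerate a) (w : L2w a) (c₃ c₂ : ℝ) :
    ∃ C : ℝ, 0 ≤ C ∧ ∀ x ∈ Ioc (0 : ℝ) 1, |jet2 w c₃ c₂ x| ≤ C := by
  obtain ⟨C, hC, hb⟩ := exists_jet3_bound h w c₃
  refine ⟨|c₂| + 2 * C, by positivity, fun x hx => ?_⟩
  have hIcc : Icc x 1 ⊆ Ioc 0 1 := fun t ht => ⟨hx.1.trans_le ht.1, ht.2⟩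
  have hd : ∀ t ∈ uIcc x 1, HasDerivAt (fun t => 2 * C * √t) (C / √t) t := by
    intro t ht
    rw [uIcc_of_le hx.2] at ht
    refine ((Real.hasDerivAt_sqrt (hIcc ht).1.ne').const_mul (2 * C)).congr_deriv ?_
    field_simp
  have c2 : ContinuousOn (fun t => C / √t) (Icc x 1) :=
    continuousOn_const.div Real.continuous_sqrt.continuousOn
      fun t ht => (Real.sqrt_pos.2 (hIcc ht).1).ne'
  have b1 : |∫ t in x..1, jet3 w c₃ t| ≤ ∫ t in x..1, C / √t := by
    rw [← Real.norm_eq_abs]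
    refine intervalIntegral.norm_integral_le_of_norm_le hx.2
      (Eventually.of_forall fun t ht => ?_) (c2.intervalIntegrable_of_Icc hx.2)
    exact hb t ⟨hx.1.trans ht.1, ht.2⟩
  rw [intervalIntegral.integral_eq_sub_of_hasDerivAt hd (c2.intervalIntegrable_of_Icc hx.2)] at b1
  rw [jet2, intervalIntegral.integral_symm]
  refine (abs_add_le _ _).trans ?_
  rw [abs_neg]
  have : 0 ≤ 2 * C * √x := by positivity
  rw [Real.sqrt_one, mul_one] at b1
  linarith

lemma aestronglyMeasurable_of_continuousOn {f : ℝ → ℝ} (hf : ContinuousOn f (Ioc 0 1)) :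
    AEStronglyMeasurable f unitVol :=
  (hf.mono Ioo_subset_Ioc_self).aestronglyMeasurable measurableSet_Ioo

lemma integrable_bdd_mul {f p : ℝ → ℝ} {C : ℝ} (hf : AEStronglyMeasurable f unitVol)
    (hb : ∀ x ∈ Ioo (0 : ℝ) 1, |f x| ≤ C) (hp : Integrable p unitVol) :
    Integrable (fun x => f x * p x) unitVol := by
  refine Integrable.bdd_mul (c := C) hp hf ?_
  filter_upwards [ae_restrict_mem measurableSet_Ioo] with x hx
  exact hb x hx

lemma integrable_jet2_mul (h : IsDegenerate a) (w : L2w a) (c₃ c₂ : ℝ) {p : ℝ → ℝ}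
    (hp : Integrable p unitVol) : Integrable (fun x => jet2 w c₃ c₂ x * p x) unitVol := by
  obtain ⟨C, -, hC⟩ := exists_jet2_bound h w c₃ c₂
  exact integrable_bdd_mul (aestronglyMeasurable_of_continuousOn (continuousOn_jet2 h w c₃ c₂))
    (fun x hx => hC x (Ioo_subset_Ioc_self hx)) hp

lemma integrable_jet2 (h : IsDegenerate a) (w : L2w a) (c₃ c₂ : ℝ) :
    Integrable (jet2 w c₃ c₂) unitVol := by
  simpa using integrable_jet2_mul h w c₃ c₂ (integrable_const (1 : ℝ))

lemma tendsto_zero_of_abs_le {f : ℝ → ℝ} {C : ℝ} (hf : ∀ x ∈ Ioc (0 : ℝ) 1, |f x| ≤ C * √x) :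
    Tendsto f (𝓝[>] 0) (𝓝 0) := by
  have h1 : Tendsto (fun x : ℝ => C * √x) (𝓝[>] 0) (𝓝 0) := by
    have : Continuous fun x : ℝ => C * √x := continuous_const.mul Real.continuous_sqrt
    have h2 := (this.tendsto 0).mono_left (nhdsWithin_le_nhds (s := Ioi 0))
    simpa using h2
  refine squeeze_zero_norm' ?_ h1
  filter_upwards [Ioc_mem_nhdsGT (zero_lt_one' ℝ)] with x hx
  exact hf x hx

/-- Green's formula `∫ u'''' φ = - u''(1) φ'(1) + ∫ u'' φ''`, if `φ(0) = φ'(0) = φ(1) = 0`. -/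
lemma inner_opJ_eq (h : IsDegenerate a) (w : L2w a) (c₃ c₂ : ℝ) (p : L2)
    (hp : prim (prim p) 1 = 0) :
    inner ℝ w (opJ h p) = -c₂ * prim p 1 + ∫ x in Ioo (0 : ℝ) 1, jet2 w c₃ c₂ x * p x := by
  obtain ⟨C, hC, hb3⟩ := exists_jet3_bound h w c₃
  obtain ⟨D, hD, hb2⟩ := exists_jet2_bound h w c₃ c₂
  have P1 := (isPrimitiveOn_prim (L2.integrable p)).mono Ioc_subset_Icc_self
  have P2 := (isPrimitiveOn_prim_prim (L2.integrable p)).mono Ioc_subset_Icc_self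
  have i1 : Integrable (fun x => w x / a x * prim (prim p) x) unitVol := by
    refine (h.integrable_mul w (opJ h p)).congr ?_
    filter_upwards [opJ_coe h p] with x hx
    rw [hx]
    ring
  have i2 := integrable_jet2_mul h w c₃ c₂ (L2.integrable p)
  -- With `φ = prim (prim p)`, the derivative of `u''' φ - u'' φ'` is `u'''' φ - u'' φ''`. At `0`
  -- the two products are `O(x^(-1/2) · x^(3/2))` and `O(x^(1/2))`, so the limit there is `0`.
  have key := (((isPrimitiveOn_jet3 h w c₃).mul P2).sub
    ((isPrimitiveOn_jet2 h w c₃ c₂).mul P1)).integral_eq_of_tendsto zero_lt_one (l := 0) ?_ ?_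
  · have e : inner ℝ w (opJ h p) = ∫ x in Ioo (0 : ℝ) 1, w x / a x * prim (prim p) x := by
      rw [h.inner_eq]
      refine integral_congr_ae ?_
      filter_upwards [opJ_coe h p] with x hx
      rw [hx]
      ring
    have e2 : ∀ x, w x / a x * prim (prim p) x + jet3 w c₃ x * prim p x -
        (jet3 w c₃ x * prim p x + jet2 w c₃ c₂ x * p x) =
        w x / a x * prim (prim p) x - jet2 w c₃ c₂ x * p x := fun x => by ring
    simp only [e2] at key
    rw [← setIntegral_Ioo_eq_intervalIntegral, integral_sub i1 i2, hp, jet2_one] at key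
    rw [e]
    linarith
  · rw [intervalIntegrable_iff_unitVol]
    refine (i1.sub i2).congr (Eventually.of_forall fun x => ?_)
    simp only [Pi.sub_apply]
    ring
  · refine tendsto_zero_of_abs_le (C := C * ‖p‖ + D * ‖p‖) fun x hx => ?_
    have hx' := Ioc_subset_Icc_self hx
    have s0 := Real.sqrt_pos.2 hx.1
    have s2 : √x * √x = x := Real.mul_self_sqrt hx.1.le
    have s1 : √x ≤ 1 := Real.sqrt_le_one.2 hx.2
    have t1 : |jet3 w c₃ x * prim (prim p) x| ≤ C * ‖p‖ * √x := by
      rw [abs_mul]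
      calc _ ≤ C / √x * (√x * ‖p‖ * x) :=
            mul_le_mul (hb3 x hx) (abs_prim_prim_le p hx') (abs_nonneg _) (by positivity)
        _ = C * ‖p‖ * x := by field_simp
        _ ≤ C * ‖p‖ * √x := by
          gcongr
          nlinarith
    have t2 : |jet2 w c₃ c₂ x * prim p x| ≤ D * ‖p‖ * √x := by
      rw [abs_mul]
      calc _ ≤ D * (√x * ‖p‖) :=
            mul_le_mul (hb2 x hx) (abs_prim_le p hx') (abs_nonneg _) hD
        _ = _ := by ring
    rw [add_mul]
    exact (abs_sub _ _).trans (add_le_add t1 t2)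

/-- The multiplier identity `∫ u'''' x u' = 3/2 ∫ u''² - 1/2 u''(1)²`. -/
lemma inner_opN_eq (h : IsDegenerate a) (w : L2w a) (c₃ c₂ : ℝ) (q : L2)
    (hq : q =ᵐ[unitVol] jet2 w c₃ c₂) (hq1 : prim q 1 = 0) :
    inner ℝ w (opN h q) = 3 / 2 * ‖q‖ ^ 2 - 1 / 2 * c₂ ^ 2 := by
  obtain ⟨C, hC, hb3⟩ := exists_jet3_bound h w c₃
  obtain ⟨D, hD, hb2⟩ := exists_jet2_bound h w c₃ c₂
  set F2 := jet2 w c₃ c₂ with hF2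
  set F3 := jet3 w c₃ with hF3
  have iF2 : Integrable F2 unitVol := integrable_jet2 h w c₃ c₂
  have m2 : MemLp F2 2 unitVol := (memLp_congr_ae hq).1 (Lp.memLp q)
  have hb3' : ∀ x ∈ Ioc (0 : ℝ) 1, |x * F3 x| ≤ C * √x := by
    intro x hx
    have s0 := Real.sqrt_pos.2 hx.1
    rw [abs_mul, abs_of_pos hx.1]
    calc x * |F3 x| ≤ x * (C / √x) := mul_le_mul_of_nonneg_left (hb3 x hx) hx.1.le
      _ = (√x * √x) * (C / √x) := by rw [Real.mul_self_sqrt hx.1.le]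
      _ = C * √x := by field_simp
  have c3 : ContinuousOn (fun x => x * F3 x) (Ioc 0 1) :=
    continuousOn_id.mul (continuousOn_jet3 h w c₃)
  have m3 : MemLp (fun x => x * F3 x) 2 unitVol := by
    refine MemLp.of_bound (aestronglyMeasurable_of_continuousOn c3) C ?_
    filter_upwards [ae_restrict_mem measurableSet_Ioo] with x hx
    refine (hb3' x (Ioo_subset_Ioc_self hx)).trans ?_
    rw [mul_comm]
    exact sqrt_mul_le (Ioo_subset_Icc_self hx) hC
  have i3 : Integrable (fun x => x * F3 x) unitVol := m3.integrable one_le_two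
  -- This is `(x u')'' = 2u'' + x u'''`, in the form the product rule produces. It lies in `L²`
  -- because `x u''' = O(√x)`, so Green's formula applies to `φ = x u'`, for which `φ'(1) = u''(1) =
  -- c₂`.
  set P : ℝ → ℝ := fun x => F2 x + (1 * F2 x + x * F3 x) with hP
  have mP : MemLp P 2 unitVol := m2.add ((m2.const_mul 1).add m3)
  set p : L2 := mP.toLp with hp
  have hpP : p =ᵐ[unitVol] P := mP.coeFn_toLp
  have iP : Integrable P unitVol := mP.integrable one_le_two
  have sub : ∀ {x : ℝ}, x ∈ Ioc (0 : ℝ) 1 → Ioc 0 x ⊆ Ioc 0 1 :=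
    fun hx => Ioc_subset_Ioc_right hx.2
  have prF2 := (isPrimitiveOn_prim iF2).mono Ioc_subset_Icc_self
  have limprim : Tendsto (prim F2) (𝓝[>] 0) (𝓝 0) := by
    refine tendsto_zero_of_abs_le (C := ‖q‖) fun x hx => ?_
    rw [← prim_congr_ae hq (Ioc_subset_Icc_self hx), mul_comm]
    exact abs_prim_le q (Ioc_subset_Icc_self hx)
  have le_sqrt : ∀ x ∈ Ioc (0 : ℝ) 1, x ≤ √x := by
    intro x hx
    have s1 : √x ≤ 1 := Real.sqrt_le_one.2 hx.2
    nlinarith [Real.mul_self_sqrt hx.1.le, Real.sqrt_nonneg x]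
  have lim2 : Tendsto (fun x => x * F2 x) (𝓝[>] 0) (𝓝 0) := by
    refine tendsto_zero_of_abs_le (C := D) fun x hx => ?_
    rw [abs_mul, abs_of_pos hx.1, mul_comm]
    exact mul_le_mul (hb2 x hx) (le_sqrt x hx) hx.1.le hD
  have e1 : ∀ x ∈ Ioc (0 : ℝ) 1, prim p x = prim F2 x + x * F2 x := by
    intro x hx
    rw [prim_congr_ae hpP (Ioc_subset_Icc_self hx), prim]
    have := ((prF2.add (IsPrimitiveOn.id.mul (isPrimitiveOn_jet2 h w c₃ c₂))).mono
      (sub hx)).integral_eq_of_tendsto hx.1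
      (intervalIntegrable_of_unitVol iP (by simp) (Ioc_subset_Icc_self hx)) (l := 0 + 0)
      (limprim.add lim2)
    rw [this]
    simp [hF2]
  have e2 : ∀ x ∈ Ioo (0 : ℝ) 1, prim (prim p) x = x * prim q x := by
    intro x hx
    have hx' := Ioo_subset_Ioc_self hx
    rw [prim_congr_ae hq (Ioc_subset_Icc_self hx')]
    have e3 : prim (prim p) x = prim (fun x => 1 * prim F2 x + x * F2 x) x := by
      refine prim_congr_ae ?_ (Ioc_subset_Icc_self hx')
      filter_upwards [ae_restrict_mem measurableSet_Ioo] with t ht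
      rw [e1 t (Ioo_subset_Ioc_self ht), one_mul]
    have i4 : Integrable (fun x => 1 * prim F2 x + x * F2 x) unitVol := by
      refine ((integrable_prim iF2).const_mul 1).add ?_
      refine integrable_bdd_mul (C := 1) measurable_id.aestronglyMeasurable (fun x hx => ?_) iF2
      rw [abs_of_pos hx.1]
      exact hx.2.le
    rw [e3, prim, ((IsPrimitiveOn.id.mul prF2).mono (sub hx')).integral_eq_of_tendsto hx.1
      (intervalIntegrable_of_unitVol i4 (by simp) (Ioc_subset_Icc_self hx')) (l := 0 * 0)
      ((tendsto_id.mono_left nhdsWithin_le_nhds).mul limprim)]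
    simp
  have eJ : opJ h p = opN h q := by
    refine Lp.ext (h.ae_iff.2 ?_)
    filter_upwards [opJ_coe h p, opN_coe h q, ae_restrict_mem measurableSet_Ioo] with x h1 h2 hx
    rw [h1, h2, e2 x hx]
  have hF21 : prim F2 1 = 0 := by rw [← prim_congr_ae hq (by simp), hq1]
  have hpp : prim (prim p) 1 = 0 := by
    have c1 := (isPrimitiveOn_prim_prim (L2.integrable p)).continuousOn_Icc
    have c2 : ContinuousOn (fun x => x * prim q x) (Icc 0 1) :=
      continuousOn_id.mul (isPrimitiveOn_prim (L2.integrable q)).continuousOn_Icc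
    have h3 : EqOn (prim (prim p)) (fun x => x * prim q x) (closure (Ioo 0 1)) :=
      EqOn.of_subset_closure (s := Ioo 0 1) e2 (by rwa [closure_Ioo (by norm_num)])
        (by rwa [closure_Ioo (by norm_num)]) subset_closure subset_rfl
    rw [closure_Ioo (by norm_num)] at h3
    rw [h3 (right_mem_Icc.2 zero_le_one)]
    simp [hq1]
  have iF22 : Integrable (fun x => F2 x * F2 x) unitVol := integrable_jet2_mul h w c₃ c₂ iF2
  have i23 : Integrable (fun x => F2 x * (x * F3 x)) unitVol := integrable_jet2_mul h w c₃ c₂ i3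
  have nq : ‖q‖ ^ 2 = ∫ x in Ioo (0 : ℝ) 1, F2 x * F2 x := by
    rw [L2.norm_sq_eq]
    refine integral_congr_ae ?_
    filter_upwards [hq] with x hx
    rw [hx, pow_two]
  have k1 := inner_opJ_eq h w c₃ c₂ p hpp
  have k2 : ∫ x in Ioo (0 : ℝ) 1, F2 x * p x =
      2 * ‖q‖ ^ 2 + ∫ x in Ioo (0 : ℝ) 1, F2 x * (x * F3 x) := by
    rw [nq, ← integral_const_mul, ← integral_add (iF22.const_mul 2) i23]
    refine integral_congr_ae ?_
    filter_upwards [hpP] with x hx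
    rw [hx, hP]
    ring
  -- Integration of `(x u''²)'` over `(0,1)`. Eliminating `∫ u'' x u'''` from Green's formula leaves
  -- `-c₂² + 2‖q‖² + (c₂² - ‖q‖²)/2`.
  have k3 : c₂ ^ 2 = ‖q‖ ^ 2 + 2 * ∫ x in Ioo (0 : ℝ) 1, F2 x * (x * F3 x) := by
    have := (IsPrimitiveOn.id.mul ((isPrimitiveOn_jet2 h w c₃ c₂).mul
      (isPrimitiveOn_jet2 h w c₃ c₂))).integral_eq_of_tendsto zero_lt_one (l := 0) ?_ ?_
    · rw [nq, ← integral_const_mul, ← integral_add iF22 (i23.const_mul 2)]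
      rw [← setIntegral_Ioo_eq_intervalIntegral, jet2_one] at this
      rw [show c₂ ^ 2 = 1 * (c₂ * c₂) - 0 by ring, ← this]
      refine integral_congr_ae (Eventually.of_forall fun x => ?_)
      simp only [hF2, hF3]
      ring
    · rw [intervalIntegrable_iff_unitVol]
      refine (iF22.add (i23.const_mul 2)).congr (Eventually.of_forall fun x => ?_)
      simp only [Pi.add_apply, hF2, hF3]
      ring
    · refine tendsto_zero_of_abs_le (C := D * D) fun x hx => ?_
      rw [abs_mul, abs_mul, abs_of_pos hx.1, mul_comm]
      exact mul_le_mul (mul_le_mul (hb2 x hx) (hb2 x hx) (abs_nonneg _) hD) (le_sqrt x hx) hx.1.le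
        (by positivity)
  rw [← eJ, k1, e1 1 ⟨one_pos, le_rfl⟩, hF21, ← hF2, k2, show F2 1 = c₂ from jet2_one w c₃ c₂]
  linarith

/-- The multiplier estimate for `∫ v x v' / a`. -/
lemma abs_inner_opN_add_le (h : IsDegenerate a) (p : L2) (hp : prim (prim p) 1 = 0) :
    |inner ℝ (opJ h p) (opN h p) + 1 / 2 * ‖opJ h p‖ ^ 2| ≤ degK a / 2 * ‖opJ h p‖ ^ 2 := by
  set f := prim (prim p) with hf
  set f₁ := prim p with hf₁
  set a' := derivWithin a (Ioc 0 1) with ha'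
  have prf : IsPrimitiveOn f f₁ (Ioc 0 1) :=
    (isPrimitiveOn_prim_prim (L2.integrable p)).mono Ioc_subset_Icc_self
  have hne : ∀ x ∈ Ioc (0 : ℝ) 1, a x ≠ 0 := fun x hx => (h.pos x hx).ne'
  -- The estimate results from integrating `(f² x / a)' = 2 f x f' / a + f² / a - (x a' / a) f² /
  -- a`. The boundary term vanishes at `1` because `f(1) = 0`, and at `0` because `f² / a` is
  -- bounded; the last summand is at most `K f² / a` in absolute value.
  have prg : IsPrimitiveOn (fun x => x / a x) (fun x => (1 * a x - x * a' x) / a x ^ 2)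
      (Ioc 0 1) := by
    have c0 : ContinuousOn (fun x => (1 * a x - x * a' x) / a x ^ 2) (Ioc 0 1) :=
      ((continuousOn_const.mul h.continuousOn).sub
        (continuousOn_id.mul h.continuousOn_derivWithin)).div (h.continuousOn.pow 2)
        fun x hx => pow_ne_zero 2 (hne x hx)
    have c1 : ContinuousOn (fun x => x / a x) (Ioc 0 1) := continuousOn_id.div h.continuousOn hne
    intro x hx y hy
    have hs : uIcc x y ⊆ Ioc 0 1 := ordConnected_Ioc.uIcc_subset hx hy
    refine ⟨(c0.mono hs).intervalIntegrable, ?_⟩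
    refine intervalIntegral.integral_eq_sub_of_hasDeriv_right (c1.mono hs) (fun z hz => ?_)
      (c0.mono hs).intervalIntegrable
    have hz' : z ∈ Ioo (0 : ℝ) 1 :=
      ⟨(lt_min hx.1 hy.1).trans hz.1, hz.2.trans_le (max_le hx.2 hy.2)⟩
    exact ((hasDerivAt_id z).div (h.hasDerivAt hz')
      (hne z (Ioo_subset_Ioc_self hz'))).hasDerivWithinAt
  have iA : Integrable (fun x => f x * (x * f₁ x) / a x) unitVol := by
    refine (h.integrable_mul (opJ h p) (opN h p)).congr ?_
    filter_upwards [opJ_coe h p, opN_coe h p] with x h1 h2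
    rw [h1, h2]
  have eA : inner ℝ (opJ h p) (opN h p) = ∫ x in Ioo (0 : ℝ) 1, f x * (x * f₁ x) / a x := by
    rw [h.inner_eq]
    refine integral_congr_ae ?_
    filter_upwards [opJ_coe h p, opN_coe h p] with x h1 h2
    rw [h1, h2]
  have iB : Integrable (fun x => f x ^ 2 / a x) unitVol := by
    refine (h.integrable_mul (opJ h p) (opJ h p)).congr ?_
    filter_upwards [opJ_coe h p] with x h1
    rw [h1, pow_two]
  have eB : ‖opJ h p‖ ^ 2 = ∫ x in Ioo (0 : ℝ) 1, f x ^ 2 / a x := by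
    rw [h.norm_sq_eq]
    refine integral_congr_ae ?_
    filter_upwards [opJ_coe h p] with x h1
    rw [h1]
  have bC : ∀ x ∈ Ioo (0 : ℝ) 1, |x * a' x / a x| ≤ degK a := by
    intro x hx
    have h3 := h.pos x (Ioo_subset_Ioc_self hx)
    rw [abs_div, abs_mul, abs_of_pos hx.1, abs_of_pos h3, div_le_iff₀ h3]
    exact h.deriv_bound (Ioo_subset_Ioc_self hx)
  have iC : Integrable (fun x => x * a' x / a x * (f x ^ 2 / a x)) unitVol :=
    integrable_bdd_mul (aestronglyMeasurable_of_continuousOn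
      ((continuousOn_id.mul h.continuousOn_derivWithin).div h.continuousOn hne)) bC iB
  have dec : ∀ x ∈ Ioo (0 : ℝ) 1, (f₁ x * f x + f x * f₁ x) * (x / a x) +
      f x * f x * ((1 * a x - x * a' x) / a x ^ 2) =
      2 * (f x * (x * f₁ x) / a x) + f x ^ 2 / a x - x * a' x / a x * (f x ^ 2 / a x) := by
    intro x hx
    have h3 := hne x (Ioo_subset_Ioc_self hx)
    field_simp
    ring
  have iAB : Integrable (fun x => 2 * (f x * (x * f₁ x) / a x) + f x ^ 2 / a x) unitVol :=
    (iA.const_mul 2).add iB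
  have iD := iAB.sub iC
  have key := ((prf.mul prf).mul prg).integral_eq_of_tendsto zero_lt_one (l := 0) ?_ ?_
  · rw [← setIntegral_Ioo_eq_intervalIntegral, setIntegral_congr_fun measurableSet_Ioo dec,
      integral_sub iAB iC, integral_add (iA.const_mul 2) iB,
      integral_const_mul, ← eA, ← eB, hp] at key
    have bnd : |∫ x in Ioo (0 : ℝ) 1, x * a' x / a x * (f x ^ 2 / a x)| ≤
        degK a * ‖opJ h p‖ ^ 2 := by
      rw [← Real.norm_eq_abs, eB, ← integral_const_mul]
      refine norm_integral_le_of_norm_le (iB.const_mul _) ?_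
      filter_upwards [ae_restrict_mem measurableSet_Ioo] with x hx
      have h3 := h.pos x (Ioo_subset_Ioc_self hx)
      have h4 : 0 ≤ f x ^ 2 / a x := by positivity
      rw [norm_mul, Real.norm_of_nonneg h4]
      exact mul_le_mul_of_nonneg_right (bC x hx) h4
    rw [abs_le] at bnd ⊢
    constructor <;> linarith [bnd.1, bnd.2]
  · rw [intervalIntegrable_iff_unitVol]
    refine iD.congr ?_
    filter_upwards [ae_restrict_mem measurableSet_Ioo] with x hx
    exact (dec x hx).symm
  · refine tendsto_zero_of_abs_le (C := ‖p‖ ^ 2 * (1 / a 1)) fun x hx => ?_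
    have h3 := h.pos x hx
    have hx0 := hx.1
    have b1 : |f x| ≤ ‖p‖ * x := (abs_prim_prim_le p (Ioc_subset_Icc_self hx)).trans
      (mul_le_mul_of_nonneg_right (sqrt_mul_le (Ioc_subset_Icc_self hx) (norm_nonneg p)) hx.1.le)
    have b2 := h.sq_div_le_of_bound hx b1
    have s1 : √x ≤ 1 := Real.sqrt_le_one.2 hx.2
    have s2 : x ≤ √x := by nlinarith [Real.mul_self_sqrt hx.1.le, Real.sqrt_nonneg x]
    have e : f x * f x * (x / a x) = f x ^ 2 / a x * x := by ring
    rw [e, abs_of_nonneg (by positivity)]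
    exact mul_le_mul b2 s2 hx.1.le ((by positivity : 0 ≤ f x ^ 2 / a x).trans b2)

/-! ### The space `H²_{1/a}` and the operator `A` -/

/-- `incl` as a bounded operator. -/
def inclL (a : ℝ → ℝ) : H2w a →L[ℝ] L2w a :=
  (WithLp.fstL 2 ℝ (L2w a) L2).comp (H2w a).subtypeL

/-- `dd` as a bounded operator. -/
def ddL (a : ℝ → ℝ) : H2w a →L[ℝ] L2 :=
  (WithLp.sndL 2 ℝ (L2w a) L2).comp (H2w a).subtypeL

@[simp] lemma ddL_apply (u : H2w a) : ddL a u = dd u := rfl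

lemma incl_add (u v : H2w a) : incl (u + v) = incl u + incl v := rfl
lemma incl_smul (c : ℝ) (u : H2w a) : incl (c • u) = c • incl u := rfl
lemma dd_add (u v : H2w a) : dd (u + v) = dd u + dd v := rfl
lemma dd_smul (c : ℝ) (u : H2w a) : dd (c • u) = c • dd u := rfl
lemma dd_sub (u v : H2w a) : dd (u - v) = dd u - dd v := rfl

lemma norm_sq_H2w (u : H2w a) : ‖u‖ ^ 2 = ‖incl u‖ ^ 2 + ‖dd u‖ ^ 2 :=
  WithLp.prod_norm_sq_eq_of_L2 (u : WithLp 2 (L2w a × L2))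

lemma H2w_ext {u v : H2w a} (h1 : incl u = incl v) (h2 : dd u = dd v) : u = v :=
  Subtype.ext (WithLp.ofLp_injective 2 (Prod.ext h1 h2))

/-- Integrating `u''` twice from `0` recovers `u`, so the second derivative determines the element,
and the clamped conditions at `1` become two linear constraints on it. -/
lemma incl_eq_opJ_and (h : IsDegenerate a) (u : H2w a) :
    incl u = opJ h (dd u) ∧ prim (dd u) 1 = 0 ∧ prim (prim (dd u)) 1 = 0 := by
  obtain ⟨f, f₁, cf, cf₁, f0, f1, f₁0, f₁1, huf, w1, w2⟩ := u.2
  have h1 : ∀ x ∈ Icc (0 : ℝ) 1, f₁ x = prim (dd u) x := fun x hx =>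
    w2.eq_integral cf₁ f₁0 (intervalIntegrable_iff_unitVol.2 (L2.integrable (dd u))) hx
  have h2 : ∀ x ∈ Icc (0 : ℝ) 1, f x = prim (prim (dd u)) x := fun x hx => by
    rw [w1.eq_integral cf f0 (intervalIntegrable_iff_unitVol.2 (integrable_of_continuousOn cf₁)) hx]
    exact prim_congr h1 hx
  refine ⟨?_, by rw [← h1 1 (by simp), f₁1], by rw [← h2 1 (by simp), f1]⟩
  refine Lp.ext ?_
  refine h.ae_iff.2 ?_
  filter_upwards [h.ae_iff.1 huf, opJ_coe h (dd u), ae_restrict_mem measurableSet_Ioo]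
    with x e1 e2 hx
  rw [e2, ← h2 x (Ioo_subset_Icc_self hx)]
  exact e1

lemma incl_eq_opJ (h : IsDegenerate a) (u : H2w a) : incl u = opJ h (dd u) :=
  (incl_eq_opJ_and h u).1

lemma prim_dd_one (h : IsDegenerate a) (u : H2w a) : prim (dd u) 1 = 0 := (incl_eq_opJ_and h u).2.1

lemma prim_prim_dd_one (h : IsDegenerate a) (u : H2w a) : prim (prim (dd u)) 1 = 0 :=
  (incl_eq_opJ_and h u).2.2

lemma norm_incl_le (h : IsDegenerate a) (u : H2w a) : ‖incl u‖ ≤ √(1 / a 1) * ‖dd u‖ := by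
  rw [incl_eq_opJ h]
  exact norm_opJ_le h _

/-- The element of `H²_{1/a}` with second derivative `p`. -/
def ofDD (h : IsDegenerate a) (p : L2) (h1 : prim p 1 = 0) (h2 : prim (prim p) 1 = 0) : H2w a :=
  ⟨WithLp.toLp 2 (opJ h p, p), prim (prim p), prim p,
    (isPrimitiveOn_prim_prim (L2.integrable p)).continuousOn_Icc,
    (isPrimitiveOn_prim (L2.integrable p)).continuousOn_Icc, by simp, h2, by simp, h1,
    h.ae_iff.2 (opJ_coe h p),
    ((isPrimitiveOn_prim_prim (L2.integrable p)).mono Ioo_subset_Icc_self).hasWeakDeriv,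
    ((isPrimitiveOn_prim (L2.integrable p)).mono Ioo_subset_Icc_self).hasWeakDeriv⟩

lemma IsPrimitiveOn.exists_eq_add_const {F G f g : ℝ → ℝ} (hF : IsPrimitiveOn F f (Ioo 0 1))
    (hG : IsPrimitiveOn G g (Ioo 0 1)) (hfg : f =ᵐ[unitVol] g) :
    ∃ c : ℝ, ∀ x ∈ Ioo (0 : ℝ) 1, F x = G x + c := by
  refine ⟨F (1 / 2) - G (1 / 2), fun x hx => ?_⟩
  have h2 : (1 / 2 : ℝ) ∈ Ioo (0 : ℝ) 1 := by norm_num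
  have e : ∫ t in (1 / 2 : ℝ)..x, f t = ∫ t in (1 / 2 : ℝ)..x, g t := by
    refine intervalIntegral.integral_congr_ae ?_
    rw [EventuallyEq, ae_restrict_iff' measurableSet_Ioo] at hfg
    filter_upwards [hfg] with z hz hzm
    exact hz (ordConnected_Ioo.uIcc_subset h2 hx (uIoc_subset_uIcc hzm))
  rw [hF.integral_eq h2 hx, hG.integral_eq h2 hx] at e
  linarith

/-- Elements of `D(A)` have a representative of the second derivative of class `C¹(0,1]`. -/
lemma HasA.exists_jet (h : IsDegenerate a) {u : H2w a} {w : L2w a} (hu : HasA u w) :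
    ∃ c₃ c₂ : ℝ, dd u =ᵐ[unitVol] jet2 w c₃ c₂ := by
  obtain ⟨f₃, f₄, h3, h4, hw⟩ := hu
  have hw' : f₄ =ᵐ[unitVol] fun x => w x / a x := by
    filter_upwards [h.ae_iff.1 hw, h.ae_pos] with x h1 h2
    rw [h1, mul_div_cancel_left₀ _ h2.ne']
  obtain ⟨G3, hG3, e3⟩ := h4.exists_isPrimitiveOn
  obtain ⟨G2, hG2, e2⟩ := h3.exists_isPrimitiveOn
  obtain ⟨c₃, hc₃⟩ := hG3.exists_eq_add_const
    ((isPrimitiveOn_jet3 h w 0).mono Ioo_subset_Ioc_self) hw'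
  have e3' : f₃ =ᵐ[unitVol] jet3 w c₃ := by
    filter_upwards [e3, ae_restrict_mem measurableSet_Ioo] with x h1 hx
    rw [h1, hc₃ x hx, jet3, jet3]
    ring
  obtain ⟨c₂, hc₂⟩ := hG2.exists_eq_add_const
    ((isPrimitiveOn_jet2 h w c₃ 0).mono Ioo_subset_Ioc_self) e3'
  refine ⟨c₃, c₂, ?_⟩
  filter_upwards [e2, ae_restrict_mem measurableSet_Ioo] with x h1 hx
  rw [h1, hc₂ x hx, jet2, jet2]
  ring

lemma hasA_of_jet (h : IsDegenerate a) {u : H2w a} {w : L2w a} {c₃ c₂ : ℝ}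
    (hu : dd u =ᵐ[unitVol] jet2 w c₃ c₂) : HasA u w := by
  refine ⟨jet3 w c₃, fun x => w x / a x, ?_, ?_, ?_⟩
  · exact ((isPrimitiveOn_jet2 h w c₃ c₂).mono Ioo_subset_Ioc_self).hasWeakDeriv.congr_left hu.symm
  · exact ((isPrimitiveOn_jet3 h w c₃).mono Ioo_subset_Ioc_self).hasWeakDeriv
  · refine h.ae_iff.2 ?_
    filter_upwards [h.ae_pos] with x hx
    rw [mul_div_cancel₀ _ hx.ne']

lemma HasA.add {u u' : H2w a} {w w' : L2w a} (h : HasA u w) (h' : HasA u' w') :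
    HasA (u + u') (w + w') := by
  obtain ⟨f₃, f₄, h1, h2, h3⟩ := h
  obtain ⟨g₃, g₄, k1, k2, k3⟩ := h'
  refine ⟨_, _, (h1.add k1).congr_left ?_, h2.add k2, ?_⟩
  · rw [dd_add]
    exact (Lp.coeFn_add _ _).symm
  · filter_upwards [Lp.coeFn_add w w', h3, k3] with x e1 e2 e3
    rw [e1, Pi.add_apply, e2, e3]
    ring

lemma HasA.smul {u : H2w a} {w : L2w a} (c : ℝ) (h : HasA u w) : HasA (c • u) (c • w) := by
  obtain ⟨f₃, f₄, h1, h2, h3⟩ := h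
  refine ⟨_, _, (h1.const_mul c).congr_left ?_, h2.const_mul c, ?_⟩
  · rw [dd_smul]
    exact (Lp.coeFn_smul c (dd u)).symm
  · filter_upwards [Lp.coeFn_smul c w, h3] with x e1 e2
    rw [e1, Pi.smul_apply, e2, smul_eq_mul]
    ring

lemma integral_jet2_mul {w : L2w a} {c₃ c₂ : ℝ} {q : L2} (hq : q =ᵐ[unitVol] jet2 w c₃ c₂) (p : L2) :
    ∫ x in Ioo (0 : ℝ) 1, jet2 w c₃ c₂ x * p x = inner ℝ q p := by
  rw [L2.inner_eq]
  refine integral_congr_ae ?_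
  filter_upwards [hq] with x hx
  rw [hx]

/-- `⟨A u, v⟩ = ⟨u'', v''⟩`. -/
lemma HasA.inner_incl (h : IsDegenerate a) {u : H2w a} {w : L2w a} (hu : HasA u w) (v : H2w a) :
    inner ℝ w (incl v) = inner ℝ (dd u) (dd v) := by
  obtain ⟨c₃, c₂, hq⟩ := hu.exists_jet h
  rw [incl_eq_opJ h v, inner_opJ_eq h w c₃ c₂ _ (prim_prim_dd_one h v), prim_dd_one h v,
    integral_jet2_mul hq]
  ring

/-- A test function with `φ(0) = φ'(0) = φ(1) = 0` and `φ'(1) = 1`, through its second derivative. -/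
def traceTest : L2 := MemLp.toLp (fun x : ℝ => 6 * x - 2) (μ := unitVol) (p := 2)
  (MemLp.of_bound (by fun_prop) 8 (by
    filter_upwards [ae_restrict_mem measurableSet_Ioo] with x hx
    rw [Real.norm_eq_abs, abs_le]
    constructor <;> linarith [hx.1, hx.2]))

lemma traceTest_coe : traceTest =ᵐ[unitVol] fun x => 6 * x - 2 := MemLp.coeFn_toLp _

lemma prim_traceTest {x : ℝ} (hx : x ∈ Icc (0 : ℝ) 1) : prim traceTest x = 3 * x ^ 2 - 2 * x := by
  rw [prim_congr_ae traceTest_coe hx]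
  refine prim_eq_of_isPrimitiveOn (F := fun x => 3 * x ^ 2 - 2 * x)
    (IsPrimitiveOn.of_hasDerivAt (fun y => ?_) (by fun_prop)) (by simp) hx
  refine (((hasDerivAt_pow 2 y).const_mul 3).sub ((hasDerivAt_id y).const_mul 2)).congr_deriv ?_
  norm_num
  ring

lemma prim_prim_traceTest : prim (prim traceTest) 1 = 0 := by
  rw [prim_congr (fun x hx => prim_traceTest hx) (by simp),
    prim_eq_of_isPrimitiveOn (F := fun x => x ^ 3 - x ^ 2)
    (IsPrimitiveOn.of_hasDerivAt (fun y => ?_) (by fun_prop)) (by simp) (by simp)]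
  · norm_num
  refine ((hasDerivAt_pow 3 y).sub (hasDerivAt_pow 2 y)).congr_deriv ?_
  norm_num

/-- The value `u''(1)` for `u ∈ D(A)` with `A u = w`. -/
def trace (h : IsDegenerate a) (u : H2w a) (w : L2w a) : ℝ :=
  -- Green's formula with `φ = x³ - x²`, for which `φ'(1) = 1`, solved for `u''(1)`. The expression
  -- is continuous in `(u'', w)`, so the observation of a classical solution is continuous in time.
  inner ℝ (dd u) traceTest - inner ℝ w (opJ h traceTest)

lemma trace_eq (h : IsDegenerate a) {u : H2w a} {w : L2w a} {c₃ c₂ : ℝ}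
    (hu : dd u =ᵐ[unitVol] jet2 w c₃ c₂) : trace h u w = c₂ := by
  rw [trace, inner_opJ_eq h w c₃ c₂ _ prim_prim_traceTest, integral_jet2_mul hu,
    prim_traceTest (by simp)]
  ring

lemma HasA.hasSecondDerivAtOne (h : IsDegenerate a) {u : H2w a} {w : L2w a} (hu : HasA u w) :
    HasSecondDerivAtOne u (trace h u w) := by
  obtain ⟨c₃, c₂, hq⟩ := hu.exists_jet h
  exact ⟨jet2 w c₃ c₂, continuousOn_jet2 h w c₃ c₂, hq, by rw [trace_eq h hq, jet2_one]⟩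

/-- `⟨A u, x u'⟩ = 3/2 ‖u''‖² - 1/2 u''(1)²`. -/
lemma HasA.inner_opN (h : IsDegenerate a) {u : H2w a} {w : L2w a} (hu : HasA u w) :
    inner ℝ w (opN h (dd u)) = 3 / 2 * ‖dd u‖ ^ 2 - 1 / 2 * trace h u w ^ 2 := by
  obtain ⟨c₃, c₂, hq⟩ := hu.exists_jet h
  rw [trace_eq h hq, inner_opN_eq h w c₃ c₂ _ hq (prim_dd_one h u)]

/-- Two almost everywhere equal representatives continuous on `(0,1]` agree on `(0,1)`, hence at its
limit point `1`. -/
lemma HasSecondDerivAtOne.unique {u : H2w a} {c c' : ℝ} (h : HasSecondDerivAtOne u c)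
    (h' : HasSecondDerivAtOne u c') : c = c' := by
  obtain ⟨f, hf, e1, rfl⟩ := h
  obtain ⟨g, hg, e2, rfl⟩ := h'
  have e3 : EqOn f g (Ioo 0 1) := Measure.eqOn_open_of_ae_eq (e1.symm.trans e2) isOpen_Ioo
    (hf.mono Ioo_subset_Ioc_self) (hg.mono Ioo_subset_Ioc_self)
  exact e3.of_subset_closure hf hg Ioo_subset_Ioc_self
    (by rw [closure_Ioo (by norm_num)]; exact Ioc_subset_Icc_self) ⟨one_pos, le_rfl⟩

lemma HasSecondDerivAtOne.sub {u u' : H2w a} {c c' : ℝ} (h : HasSecondDerivAtOne u c)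
    (h' : HasSecondDerivAtOne u' c') : HasSecondDerivAtOne (u - u') (c - c') := by
  obtain ⟨f, hf, e1, rfl⟩ := h
  obtain ⟨g, hg, e2, rfl⟩ := h'
  refine ⟨fun x => f x - g x, hf.sub hg, ?_, rfl⟩
  filter_upwards [Lp.coeFn_sub (dd u) (dd u'), e1, e2] with x h1 h2 h3
  rw [dd_sub, h1, Pi.sub_apply, h2, h3]

lemma energy_eq (h : IsDegenerate a) (u : H2w a) (v : L2w a) :
    energy u v = 1 / 2 * (‖v‖ ^ 2 + ‖dd u‖ ^ 2) := by
  rw [energy, integral_add, h.norm_sq_eq, L2.norm_sq_eq]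
  · simpa only [pow_two] using h.integrable_mul v v
  · exact (Lp.memLp (dd u)).integrable_sq

lemma abs_inner_opN_dd_add_le (h : IsDegenerate a) (v : H2w a) :
    |inner ℝ (incl v) (opN h (dd v)) + 1 / 2 * ‖incl v‖ ^ 2| ≤ degK a / 2 * ‖incl v‖ ^ 2 := by
  rw [incl_eq_opJ h v]
  exact abs_inner_opN_add_le h _ (prim_prim_dd_one h v)

/-! ### Estimates for classical solutions -/

lemma sub_le_integral_of_hasDerivWithinAt {g g' f : ℝ → ℝ} {T : ℝ} (hT : 0 ≤ T)
    (hg : ∀ t ∈ Ici (0 : ℝ), HasDerivWithinAt g (g' t) (Ici 0) t)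
    (hg' : ContinuousOn g' (Ici 0)) (hf : ContinuousOn f (Ici 0))
    (hle : ∀ t ∈ Ici (0 : ℝ), g' t ≤ f t) : g T - g 0 ≤ ∫ t in (0 : ℝ)..T, f t := by
  have hsub : Icc 0 T ⊆ Ici 0 := Icc_subset_Ici_self
  have i1 : IntervalIntegrable g' volume 0 T := (hg'.mono hsub).intervalIntegrable_of_Icc hT
  have i2 : IntervalIntegrable f volume 0 T := (hf.mono hsub).intervalIntegrable_of_Icc hT
  have e := intervalIntegral.integral_eq_sub_of_hasDeriv_right_of_le hT
    (fun t ht => ((hg t (hsub ht)).continuousWithinAt).mono hsub)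
    (fun t ht => (hg t ht.1.le).mono (Ioi_subset_Ici ht.1.le)) i1
  rw [← e]
  exact intervalIntegral.integral_mono_on hT i1 i2 fun t ht => hle t (hsub ht)

/-- Cauchy–Schwarz followed by `2‖v‖‖u''‖ ≤ ‖v‖² + ‖u''‖²`. It bounds both multipliers, with `r = x
y_x` and with `r = y`. -/
lemma abs_inner_le_energy (h : IsDegenerate a) (u : H2w a) (v r : L2w a)
    (hr : ‖r‖ ≤ √(1 / a 1) * ‖dd u‖) : |inner ℝ v r| ≤ √(1 / a 1) * energy u v := by
  rw [energy_eq h]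
  refine (abs_real_inner_le_norm v r).trans ?_
  have h1 : ‖v‖ * ‖r‖ ≤ ‖v‖ * (√(1 / a 1) * ‖dd u‖) :=
    mul_le_mul_of_nonneg_left hr (norm_nonneg v)
  nlinarith [mul_nonneg (Real.sqrt_nonneg (1 / a 1)) (sq_nonneg (‖v‖ - ‖dd u‖))]

lemma energy_nonneg (h : IsDegenerate a) (u : H2w a) (v : L2w a) : 0 ≤ energy u v := by
  rw [energy_eq h]
  positivity

/-- With `s = 2√(1/a(1))` one has `s ≤ max(1, s²)` and `s² = 4/a(1)`. -/
lemma two_mul_sqrt_le {c : ℝ} (h : IsDegenerate a) : 2 * √(1 / a 1) ≤ max 1 (max (4 / a 1) c) := by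
  have h1 := h.a_one_pos
  have h2 : √(1 / a 1) ^ 2 = 1 / a 1 := Real.sq_sqrt (by positivity)
  have h3 : 1 ≤ max 1 (max (4 / a 1) c) := le_max_left _ _
  have h4 : 4 / a 1 ≤ max 1 (max (4 / a 1) c) := (le_max_left _ _).trans (le_max_right _ _)
  have h5 : 4 / a 1 = 4 * √(1 / a 1) ^ 2 := by rw [h2]; ring
  rw [h5] at h3 h4 ⊢
  nlinarith [sq_nonneg (2 * √(1 / a 1) - 1)]

/-- The energy of a classical solution is constant. -/
lemma IsClassicalSolution.energy_eq (h : IsDegenerate a) {y yt : ℝ → H2w a}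
    (hy : IsClassicalSolution a y yt) {t : ℝ} (ht : 0 ≤ t) :
    energy (y t) (incl (yt t)) = energy (y 0) (incl (yt 0)) := by
  obtain ⟨ytt, -, htt⟩ := hy.eqn
  have hd : ∀ s ∈ Ici (0 : ℝ), HasDerivWithinAt
      (fun s => 1 / 2 * (‖incl (yt s)‖ ^ 2 + ‖dd (y s)‖ ^ 2)) 0 (Ici 0) s := by
    intro s hs
    have h1 := (htt s hs).1.norm_sq
    have h2 := ((ddL a).hasFDerivAt.comp_hasDerivWithinAt s (hy.deriv_t s hs)).norm_sq
    refine ((h1.add h2).const_mul (1 / 2)).congr_deriv ?_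
    -- The derivative of the energy is `⟨y_tt, y_t⟩ + ⟨y_xx, y_txx⟩`, and `⟨A y, y_t⟩ = ⟨y_xx,
    -- y_txx⟩` cancels it.
    have h3 := (htt s hs).2.inner_incl h (yt s)
    rw [inner_neg_left, real_inner_comm] at h3
    simp only [Function.comp_apply, ddL_apply]
    linarith
  simp only [DegBeam.energy_eq h]
  refine constant_of_has_deriv_right_zero (a := 0) (b := t)
    (f := fun s => 1 / 2 * (‖incl (yt s)‖ ^ 2 + ‖dd (y s)‖ ^ 2)) (fun s hs => ?_) (fun s hs => ?_) t
    ⟨ht, le_rfl⟩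
  · exact (hd s hs.1).continuousWithinAt.mono Icc_subset_Ici_self
  · exact (hd s hs.1).mono (Ici_subset_Ici.2 hs.1)

/-- Hidden regularity and observability for classical solutions. -/
lemma IsClassicalSolution.exists_trace (h : IsDegenerate a) {y yt : ℝ → H2w a}
    (hy : IsClassicalSolution a y yt) :
    ∃ τ : ℝ → ℝ, ContinuousOn τ (Ici 0) ∧ (∀ t, 0 ≤ t → HasSecondDerivAtOne (y t) (τ t)) ∧
      ∀ T, 0 ≤ T →
        ∫ t in (0 : ℝ)..T, τ t ^ 2 ≤ (4 * √(1 / a 1) + 6 * T) * energy (y 0) (incl (yt 0)) ∧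
        (T * (2 - degK a) - 4 * max 1 (max (4 / a 1) (4 * degK a / a 1))) *
          energy (y 0) (incl (yt 0)) ≤ ∫ t in (0 : ℝ)..T, τ t ^ 2 := by
  have hE := fun {t : ℝ} (ht : 0 ≤ t) => hy.energy_eq h ht
  obtain ⟨ytt, ctt, htt⟩ := hy.eqn
  set E := energy (y 0) (incl (yt 0)) with hEdef
  have hE0 : 0 ≤ E := energy_nonneg h _ _
  have cy : ContinuousOn y (Ici 0) := fun t ht => (hy.deriv_t t ht).continuousWithinAt
  have cdd : ContinuousOn (fun t => dd (y t)) (Ici 0) := (ddL a).continuous.comp_continuousOn cy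
  have cddt : ContinuousOn (fun t => dd (yt t)) (Ici 0) :=
    (ddL a).continuous.comp_continuousOn hy.cont_t
  have ci : ContinuousOn (fun t => incl (y t)) (Ici 0) := (inclL a).continuous.comp_continuousOn cy
  have cit : ContinuousOn (fun t => incl (yt t)) (Ici 0) :=
    (inclL a).continuous.comp_continuousOn hy.cont_t
  have cN : ContinuousOn (fun t => opN h (dd (y t))) (Ici 0) :=
    (opN h).continuous.comp_continuousOn cdd
  have cNt : ContinuousOn (fun t => opN h (dd (yt t))) (Ici 0) :=
    (opN h).continuous.comp_continuousOn cddt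
  set τ : ℝ → ℝ := fun t => trace h (y t) (-ytt t) with hτ
  have cτ : ContinuousOn τ (Ici 0) :=
    (cdd.inner continuousOn_const).sub (ctt.neg.inner continuousOn_const)
  set ρ : ℝ → ℝ := fun t => inner ℝ (incl (yt t)) (opN h (dd (y t))) with hρ
  set ρ' : ℝ → ℝ := fun t => inner ℝ (incl (yt t)) (opN h (dd (yt t))) +
    inner ℝ (ytt t) (opN h (dd (y t))) with hρ'
  set B : ℝ → ℝ := fun t => inner ℝ (incl (yt t)) (incl (y t)) with hB
  set B' : ℝ → ℝ := fun t => inner ℝ (incl (yt t)) (incl (yt t)) +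
    inner ℝ (ytt t) (incl (y t)) with hB'
  have dρ : ∀ t ∈ Ici (0 : ℝ), HasDerivWithinAt ρ (ρ' t) (Ici 0) t := fun t ht =>
    (htt t ht).1.inner ℝ
      (((opN h).comp (ddL a)).hasFDerivAt.comp_hasDerivWithinAt t (hy.deriv_t t ht))
  have dB : ∀ t ∈ Ici (0 : ℝ), HasDerivWithinAt B (B' t) (Ici 0) t := fun t ht =>
    (htt t ht).1.inner ℝ ((inclL a).hasFDerivAt.comp_hasDerivWithinAt t (hy.deriv_t t ht))
  have cρ' : ContinuousOn ρ' (Ici 0) := (cit.inner cNt).add (ctt.inner cN)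
  have cB' : ContinuousOn B' (Ici 0) := (cit.inner cit).add (ctt.inner ci)
  have bρ : ∀ t, 0 ≤ t → |ρ t| ≤ √(1 / a 1) * E := fun t ht => by
    rw [← hE ht]
    exact abs_inner_le_energy h _ _ _ (norm_opN_le h _)
  have bB : ∀ t, 0 ≤ t → |B t| ≤ √(1 / a 1) * E := fun t ht => by
    rw [← hE ht]
    exact abs_inner_le_energy h _ _ _ (norm_incl_le h _)
  have K0 := h.degK_nonneg
  have K2 := h.K_lt
  -- The starting point is `τ²/2 = ρ' + 3/2 ‖y_xx‖² - ⟨y_t, x y_tx⟩`, whose last term lies between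
  -- `(1-K)/2 ‖y_t‖²` and `(1+K)/2 ‖y_t‖²`. The upper bound uses `(1+K)/2 ≤ 3/2`. In the lower bound
  -- the weight `K/4` of `B'` makes the coefficients of `‖y_t‖²` coincide, since `-K/4 + (2-K)/4 =
  -- (1-K)/2`; that of `‖y_xx‖²` is `K/4 + (2-K)/4 = 1/2 ≤ 3/2`.
  have pt : ∀ t, 0 ≤ t → 1 / 2 * τ t ^ 2 ≤ ρ' t + 3 * E ∧
      ρ' t - degK a / 4 * B' t + (2 - degK a) / 2 * E ≤ 1 / 2 * τ t ^ 2 := by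
    intro t ht
    have e1 := (htt t ht).2.inner_opN h
    have e2 := (htt t ht).2.inner_incl h (y t)
    have e3 := abs_le.1 (abs_inner_opN_dd_add_le h (yt t))
    have e4 := hE ht
    rw [DegBeam.energy_eq h] at e4
    rw [inner_neg_left] at e1 e2
    rw [real_inner_self_eq_norm_sq] at e2
    simp only [hρ', hB', hτ]
    rw [real_inner_self_eq_norm_sq]
    have p1 : 0 ≤ ‖incl (yt t)‖ ^ 2 := by positivity
    have p2 : 0 ≤ ‖dd (y t)‖ ^ 2 := by positivity
    constructor
    · nlinarith [e3.1]
    · nlinarith [e3.2]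
  refine ⟨τ, cτ, fun t ht => (htt t ht).2.hasSecondDerivAtOne h, fun T hT => ⟨?_, ?_⟩⟩
  · have key := sub_le_integral_of_hasDerivWithinAt hT
      (g := fun t => -(ρ t + 3 * E * t)) (g' := fun t => -(ρ' t + 3 * E))
      (f := fun t => -(1 / 2) * τ t ^ 2)
      (fun t ht => ((dρ t ht).add (((hasDerivWithinAt_id t _).const_mul (3 * E)).congr_deriv
        (by simp))).neg)
      (cρ'.add continuousOn_const).neg (continuousOn_const.mul (cτ.pow 2))
      (fun t ht => by have := (pt t ht).1; linarith)
    rw [intervalIntegral.integral_const_mul] at key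
    have b1 := abs_le.1 (bρ T hT)
    have b2 := abs_le.1 (bρ 0 le_rfl)
    nlinarith [b1.1, b1.2, b2.1, b2.2]
  · have key := sub_le_integral_of_hasDerivWithinAt hT
      (g := fun t => ρ t - degK a / 4 * B t + (2 - degK a) / 2 * E * t)
      (g' := fun t => ρ' t - degK a / 4 * B' t + (2 - degK a) / 2 * E)
      (f := fun t => 1 / 2 * τ t ^ 2)
      (fun t ht => ((dρ t ht).sub ((dB t ht).const_mul _)).add
        (((hasDerivWithinAt_id t _).const_mul ((2 - degK a) / 2 * E)).congr_deriv (by simp)))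
      ((cρ'.sub (continuousOn_const.mul cB')).add continuousOn_const)
      (continuousOn_const.mul (cτ.pow 2))
      (fun t ht => (pt t ht).2)
    rw [intervalIntegral.integral_const_mul] at key
    have b1 := abs_le.1 (bρ T hT)
    have b2 := abs_le.1 (bρ 0 le_rfl)
    -- Here `K/4 ≤ 1/2` because `K < 2`. With `s = √(1/a(1))`, the end values of `ρ` cost at most
    -- `2sE` and those of `K/4 · B` at most `sE`. After doubling, the loss `6sE` is covered by the
    -- constant, which is at least `8s`.
    have b3 : |degK a / 4 * B T| ≤ 1 / 2 * (√(1 / a 1) * E) := by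
      rw [abs_mul, abs_of_nonneg (by positivity)]
      exact mul_le_mul (by linarith) (bB T hT) (abs_nonneg _) (by norm_num)
    have b4 : |degK a / 4 * B 0| ≤ 1 / 2 * (√(1 / a 1) * E) := by
      rw [abs_mul, abs_of_nonneg (by positivity)]
      exact mul_le_mul (by linarith) (bB 0 le_rfl) (abs_nonneg _) (by norm_num)
    rw [abs_le] at b3 b4
    have hM : 2 * √(1 / a 1) * E ≤ max 1 (max (4 / a 1) (4 * degK a / a 1)) * E :=
      mul_le_mul_of_nonneg_right (two_mul_sqrt_le h) hE0
    have hs : 0 ≤ √(1 / a 1) * E := by positivity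
    rw [sub_mul]
    linarith [b1.1, b2.2, b3.2, b4.1]

lemma IsClassicalSolution.add {y yt z zt : ℝ → H2w a} (hy : IsClassicalSolution a y yt)
    (hz : IsClassicalSolution a z zt) :
    IsClassicalSolution a (fun t => y t + z t) (fun t => yt t + zt t) := by
  obtain ⟨u, cu, hu⟩ := hy.eqn
  obtain ⟨v, cv, hv⟩ := hz.eqn
  refine ⟨fun t ht => (hy.deriv_t t ht).add (hz.deriv_t t ht), hy.cont_t.add hz.cont_t,
    fun t => u t + v t, cu.add cv, fun t ht => ⟨(hu t ht).1.add (hv t ht).1, ?_⟩⟩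
  rw [neg_add]
  exact (hu t ht).2.add (hv t ht).2

lemma IsClassicalSolution.smul (c : ℝ) {y yt : ℝ → H2w a} (hy : IsClassicalSolution a y yt) :
    IsClassicalSolution a (fun t => c • y t) (fun t => c • yt t) := by
  obtain ⟨u, cu, hu⟩ := hy.eqn
  refine ⟨fun t ht => (hy.deriv_t t ht).const_smul c, hy.cont_t.const_smul c,
    fun t => c • u t, cu.const_smul c, fun t ht => ⟨(hu t ht).1.const_smul c, ?_⟩⟩
  rw [← smul_neg]
  exact (hu t ht).2.smul c

lemma IsClassicalSolution.sub {y yt z zt : ℝ → H2w a} (hy : IsClassicalSolution a y yt)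
    (hz : IsClassicalSolution a z zt) :
    IsClassicalSolution a (fun t => y t - z t) (fun t => yt t - zt t) := by
  simpa only [neg_one_smul, sub_eq_add_neg] using hy.add (hz.smul (-1))

/-! ### Compactness -/

/-- A uniform bound on `u'` alone makes `u = O(x)` and so controls `u` in `L²_{1/a}`. Compactness of
`J` thereby reduces to uniform compactness of the derivatives. -/
lemma norm_opJ_le_of_abs_prim_le (h : IsDegenerate a) (p : L2) {C : ℝ} (hC : 0 ≤ C)
    (hp : ∀ x ∈ Icc (0 : ℝ) 1, |prim p x| ≤ C) : ‖opJ h p‖ ≤ √(1 / a 1) * C := by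
  refine h.norm_le_of_bound hC _ (opJ_coe h p) fun x hx => ?_
  have := intervalIntegral.norm_integral_le_of_norm_le_const (a := 0) (b := x) (f := prim p)
    (C := C) fun t ht => ?_
  · rw [sub_zero, abs_of_nonneg hx.1.le] at this
    exact this
  · rw [uIoc_of_le hx.1.le] at ht
    exact hp t ⟨ht.1.le, ht.2.trans hx.2.le⟩

/-- The restriction of `prim p` to `[0,1]`. -/
def primBCF (p : L2) : BoundedContinuousFunction (Icc (0 : ℝ) 1) ℝ :=
  BoundedContinuousFunction.mkOfCompact ⟨fun x => prim p x,
    (isPrimitiveOn_prim (L2.integrable p)).continuousOn_Icc.domRestrict⟩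

/-- Arzelà–Ascoli: on the unit ball the primitives take values in `[-1,1]` and share the modulus of
continuity `√d`. -/
lemma totallyBounded_primBCF : TotallyBounded (primBCF '' Metric.closedBall 0 1) := by
  have hb : ∀ p ∈ Metric.closedBall (0 : L2) 1, ‖p‖ ≤ 1 := fun p hp => by simpa using hp
  refine (BoundedContinuousFunction.arzela_ascoli (Icc (-1 : ℝ) 1) isCompact_Icc _ ?_
    ?_).totallyBounded.subset subset_closure
  · rintro _ x ⟨p, hp, rfl⟩
    refine abs_le.1 ?_
    exact (abs_prim_le p x.2).trans ((sqrt_mul_le x.2 (norm_nonneg p)).trans (hb p hp))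
  · refine Metric.equicontinuous_of_continuity_modulus (fun d => √d) ?_ _ ?_
    · simpa using Real.continuous_sqrt.tendsto 0
    · rintro x y ⟨_, p, hp, rfl⟩
      have key : ∀ x y : Icc (0 : ℝ) 1, (x : ℝ) ≤ y →
          |prim p y - prim p x| ≤ √|(y : ℝ) - x| := by
        intro x y hxy
        rw [abs_of_nonneg (sub_nonneg.2 hxy)]
        exact (abs_prim_sub_le p x.2.1 hxy y.2.2).trans
          (mul_le_of_le_one_right (Real.sqrt_nonneg _) (hb p hp))
      change |prim p x - prim p y| ≤ √|(x : ℝ) - y|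
      rcases le_total (x : ℝ) y with hxy | hxy
      · rw [abs_sub_comm, abs_sub_comm (x : ℝ)]
        exact key x y hxy
      · exact key y x hxy

lemma isCompactOperator_opJ (h : IsDegenerate a) : IsCompactOperator (opJ h) := by
  rw [isCompactOperator_iff_exists_mem_nhds_isCompact_closure_image]
  refine ⟨Metric.closedBall 0 1, Metric.closedBall_mem_nhds 0 one_pos, ?_⟩
  have hc := h.a_one_pos
  refine TotallyBounded.isCompact_of_isClosed (TotallyBounded.closure ?_) isClosed_closure
  rw [Metric.totallyBounded_iff]
  intro ε hε
  set s := √(1 / a 1) with hs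
  have hs0 : 0 < s := Real.sqrt_pos.2 (by positivity)
  -- The centres are taken in the image itself, so each is the primitive of some `q`. Uniform
  -- distance below `ε/(2s)` between primitives becomes distance at most `ε/2` under `opJ`.
  obtain ⟨t', ht's, ht'f, hcov⟩ := exists_subset_image_finite_and.1
    (Metric.finite_approx_of_totallyBounded totallyBounded_primBCF (ε / (2 * s)) (by positivity))
  refine ⟨opJ h '' t', ht'f.image _, ?_⟩
  rintro _ ⟨p, hp, rfl⟩
  obtain ⟨_, ⟨q, hq, rfl⟩, hpq⟩ := mem_iUnion₂.1 (hcov (mem_image_of_mem _ hp))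
  refine mem_iUnion₂.2 ⟨_, mem_image_of_mem _ hq, ?_⟩
  rw [Metric.mem_ball, dist_eq_norm, ← map_sub]
  refine lt_of_le_of_lt (norm_opJ_le_of_abs_prim_le h _ (C := ε / (2 * s)) (by positivity)
    fun x hx => ?_) ?_
  · have h1 := (BoundedContinuousFunction.dist_coe_le_dist (f := primBCF p) (g := primBCF q)
      ⟨x, hx⟩).trans (Metric.mem_ball.1 hpq).le
    have h2 : prim (p - q : L2) x = prim p x - prim q x := by
      have := prim_coe_add (p - q) q hx
      rw [sub_add_cancel] at this
      linarith
    rw [h2]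
    exact h1
  · have : s * (ε / (2 * s)) = ε / 2 := by field_simp
    linarith

/-! ### Second derivatives of elements of `H²_{1/a}` -/

/-- The constant function `1`. -/
def oneL2 : L2 := MemLp.toLp (fun _ : ℝ => (1 : ℝ)) (μ := unitVol) (p := 2) (memLp_const 1)

/-- The identity function. -/
def idL2 : L2 := MemLp.toLp (fun x : ℝ => x) (μ := unitVol) (p := 2)
  (MemLp.of_bound (by fun_prop) 1 (by
    filter_upwards [ae_restrict_mem measurableSet_Ioo] with x hx
    rw [Real.norm_eq_abs, abs_of_pos hx.1]
    exact hx.2.le))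

lemma inner_oneL2 (p : L2) : inner ℝ oneL2 p = prim p 1 := by
  rw [L2.inner_eq, prim, ← setIntegral_Ioo_eq_intervalIntegral]
  refine integral_congr_ae ?_
  filter_upwards [MemLp.coeFn_toLp (memLp_const (1 : ℝ)) (μ := unitVol) (p := 2)] with x hx
  rw [oneL2, hx, one_mul]

lemma integrable_id_mul (p : L2) : Integrable (fun x => x * p x) unitVol :=
  integrable_bdd_mul (C := 1) measurable_id.aestronglyMeasurable (fun x hx => by
    rw [abs_of_pos hx.1]; exact hx.2.le) (L2.integrable p)

lemma inner_idL2 (p : L2) : inner ℝ idL2 p = prim p 1 - prim (prim p) 1 := by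
  have e : inner ℝ idL2 p = ∫ x in Ioo (0 : ℝ) 1, x * p x := by
    rw [L2.inner_eq]
    refine integral_congr_ae ?_
    have : idL2 =ᵐ[unitVol] fun x => x := MemLp.coeFn_toLp _
    filter_upwards [this] with x hx
    rw [hx]
  have key := (IsPrimitiveOn.id.mul (isPrimitiveOn_prim (L2.integrable p))).integral_eq
    (left_mem_Icc.2 zero_le_one) (right_mem_Icc.2 zero_le_one)
  have i1 := intervalIntegrable_iff_unitVol.2 (integrable_prim (L2.integrable p))
  have i2 := intervalIntegrable_iff_unitVol.2 (integrable_id_mul p)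
  simp only [one_mul, prim_zero, mul_zero, sub_zero] at key
  rw [intervalIntegral.integral_add i1 i2, ← setIntegral_Ioo_eq_intervalIntegral (fun x => x * p x),
    ← e] at key
  have e2 : prim (prim p) 1 = ∫ x in (0 : ℝ)..1, prim p x := rfl
  linarith

/-- The space of second derivatives of elements of `H²₀(0,1)`. -/
abbrev ddSpace : Submodule ℝ L2 := (Submodule.span ℝ {oneL2, idL2})ᗮ

/-- After one integration by parts, the conditions `u'(1) = 0` and `u(1) = 0` say that `u''` is
orthogonal to `1` and `x`. -/
lemma mem_ddSpace {p : L2} : p ∈ ddSpace ↔ prim p 1 = 0 ∧ prim (prim p) 1 = 0 := by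
  rw [Submodule.mem_orthogonal]
  constructor
  · intro H
    have h1 := H oneL2 (Submodule.subset_span (by simp))
    have h2 := H idL2 (Submodule.subset_span (by simp))
    rw [inner_oneL2] at h1
    rw [inner_idL2] at h2
    exact ⟨h1, by linarith⟩
  · rintro ⟨h1, h2⟩ u hu
    obtain ⟨α, β, rfl⟩ := Submodule.mem_span_pair.1 hu
    rw [inner_add_left, real_inner_smul_left, real_inner_smul_left, inner_oneL2, inner_idL2, h1, h2]
    simp

/-- The bounded inverse of `u ↦ u''`. -/
def liftDD (h : IsDegenerate a) : ddSpace →L[ℝ] H2w a :=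
  LinearMap.mkContinuous
    { toFun := fun p => ofDD h p (mem_ddSpace.1 p.2).1 (mem_ddSpace.1 p.2).2
      map_add' := fun p q => H2w_ext (map_add (opJ h) _ _) rfl
      map_smul' := fun c p => H2w_ext (map_smul (opJ h) _ _) rfl }
    (√(1 / a 1) + 1)
    fun p => by
      refine abs_le_of_sq_le_sq' ?_ (by positivity) |>.2
      rw [norm_sq_H2w]
      have h1 := norm_opJ_le h (p : L2)
      have h2 : ‖opJ h (p : L2)‖ ^ 2 ≤ (√(1 / a 1) * ‖(p : L2)‖) ^ 2 :=
        pow_le_pow_left₀ (norm_nonneg _) h1 2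
      have h3 : 0 ≤ √(1 / a 1) * ‖(p : L2)‖ ^ 2 := by positivity
      change ‖opJ h (p : L2)‖ ^ 2 + ‖(p : L2)‖ ^ 2 ≤ ((√(1 / a 1) + 1) * ‖(p : L2)‖) ^ 2
      nlinarith

@[simp] lemma dd_liftDD (h : IsDegenerate a) (p : ddSpace) : dd (liftDD h p) = p := rfl

lemma liftDD_surjective (h : IsDegenerate a) : Function.Surjective (liftDD h) := fun u =>
  ⟨⟨dd u, mem_ddSpace.2 ⟨prim_dd_one h u, prim_prim_dd_one h u⟩⟩,
    H2w_ext (incl_eq_opJ h u).symm rfl⟩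

/-- `opJ` on the space of second derivatives of elements of `H²₀(0,1)`. -/
def opJW (h : IsDegenerate a) : ddSpace →L[ℝ] L2w a := (opJ h).comp ddSpace.subtypeL

lemma HasWeakDeriv.ae_eq_zero {f g : ℝ → ℝ} (hfg : HasWeakDeriv f g) (hf : f =ᵐ[unitVol] 0) :
    g =ᵐ[unitVol] 0 := by
  have h1 := hfg.congr_left hf
  have main := isOpen_Ioo.ae_eq_zero_of_integral_contDiff_smul_eq_zero (μ := volume) h1.2.1 ?_
  · rw [EventuallyEq, ae_restrict_iff' measurableSet_Ioo]
    exact main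
  · intro φ hφ hc hs
    have h2 := h1.2.2 φ hφ hc hs
    simp only [Pi.zero_apply, zero_mul, integral_zero] at h2
    rw [← setIntegral_eq_integral_of_forall_compl_eq_zero (s := Ioo 0 1)]
    · simp only [smul_eq_mul, mul_comm (φ _)]
      linarith
    · intro x hx
      rw [image_eq_zero_of_notMem_tsupport fun hx' => hx (hs hx'), zero_smul]

lemma opJ_injective (h : IsDegenerate a) {p : L2} (hp : opJ h p = 0) : p = 0 := by
  have h1 : prim (prim p) =ᵐ[unitVol] 0 := by
    filter_upwards [opJ_coe h p, h.ae_iff.1 (Lp.coeFn_zero ℝ 2 (wMeasure a))] with x e1 e2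
    rw [← e1, hp, e2]
  have h2 := ((isPrimitiveOn_prim_prim (L2.integrable p)).mono
    Ioo_subset_Icc_self).hasWeakDeriv.ae_eq_zero h1
  have h3 := ((isPrimitiveOn_prim (L2.integrable p)).mono
    Ioo_subset_Icc_self).hasWeakDeriv.ae_eq_zero h2
  exact Lp.ext (h3.trans (Lp.coeFn_zero _ _ _).symm)

/-- Every test function on `(0,1)` is `opJ` of its second derivative, which lies in `ddSpace`; so `w
/ a` integrates to zero against all test functions. This is injectivity of the adjoint of `J`. -/
lemma eq_zero_of_inner_opJ (h : IsDegenerate a) {w : L2w a}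
    (hw : ∀ p ∈ ddSpace, inner ℝ w (opJ h p) = 0) : w = 0 := by
  have main := isOpen_Ioo.ae_eq_zero_of_integral_contDiff_smul_eq_zero (μ := volume)
    ((isPrimitiveOn_jet3 h w 0).mono Ioo_subset_Ioc_self).locallyIntegrableOn ?_
  · refine Lp.ext (h.ae_iff.2 ?_)
    have h0 := h.ae_iff.1 (Lp.coeFn_zero ℝ 2 (wMeasure a))
    have main' : ∀ᵐ x ∂unitVol, w x / a x = 0 := (ae_restrict_iff' measurableSet_Ioo).2 main
    filter_upwards [main', h.ae_pos, h0] with x e1 e2 e3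
    rw [e3, Pi.zero_apply]
    simpa [e2.ne'] using e1
  intro φ hφ hc hs
  have h0 : ∀ x : ℝ, x ∉ Ioo (0 : ℝ) 1 → φ x = 0 ∧ deriv φ x = 0 := fun x hx =>
    ⟨image_eq_zero_of_notMem_tsupport fun hx' => hx (hs hx'),
      image_eq_zero_of_notMem_tsupport fun hx' =>
        hx (hs (closure_minimal support_deriv_subset (isClosed_tsupport φ) hx'))⟩
  have hφ1 : ContDiff ℝ ∞ (deriv φ) := (contDiff_infty_iff_deriv.1 hφ).2
  have c2 : Continuous (deriv (deriv φ)) := hφ1.continuous_deriv (by simp)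
  have m2 : MemLp (deriv (deriv φ)) 2 unitVol := by
    have : HasCompactSupport (deriv (deriv φ)) := hc.deriv.deriv
    exact (c2.memLp_of_hasCompactSupport this).restrict _
  set p : L2 := m2.toLp with hp
  have e1 : ∀ x ∈ Icc (0 : ℝ) 1, prim p x = deriv φ x := fun x hx => by
    rw [prim_congr_ae m2.coeFn_toLp hx]
    exact prim_eq_of_isPrimitiveOn (IsPrimitiveOn.of_hasDerivAt
      (fun x => (hφ1.differentiable (by simp) x).hasDerivAt) c2) (h0 0 (by simp)).2 hx
  have e2 : ∀ x ∈ Icc (0 : ℝ) 1, prim (prim p) x = φ x := fun x hx => by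
    rw [prim_congr e1 hx]
    exact prim_eq_of_isPrimitiveOn (IsPrimitiveOn.of_hasDerivAt
      (fun x => (hφ.differentiable (by simp) x).hasDerivAt) hφ1.continuous) (h0 0 (by simp)).1 hx
  have hpm : p ∈ ddSpace := mem_ddSpace.2
    ⟨by rw [e1 1 (by simp), (h0 1 (by simp)).2], by rw [e2 1 (by simp), (h0 1 (by simp)).1]⟩
  have key := hw p hpm
  rw [h.inner_eq] at key
  have e3 : ∫ x, φ x • (w x / a x) = ∫ x in Ioo (0 : ℝ) 1, φ x • (w x / a x) :=
    (setIntegral_eq_integral_of_forall_compl_eq_zero fun x hx => by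
      rw [(h0 x hx).1, zero_smul]).symm
  refine e3.trans (Eq.trans ?_ key)
  refine integral_congr_ae (μ := unitVol) ?_
  filter_upwards [opJ_coe h p, ae_restrict_mem measurableSet_Ioo] with x k1 k2
  rw [k1, e2 x (Ioo_subset_Icc_self k2), smul_eq_mul]
  ring

/-! ### Eigenfunctions -/

lemma jet2_eq_add (h : IsDegenerate a) (w : L2w a) (c₃ c₂ : ℝ) {x : ℝ} (hx : x ∈ Ioc (0 : ℝ) 1) :
    jet2 w c₃ c₂ x = jet2 w 0 0 x + (c₂ + c₃ * (x - 1)) := by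
  have h1 := (isPrimitiveOn_jet2 h w 0 0).intervalIntegrable (x := 1) ⟨one_pos, le_rfl⟩ hx
  have h2 : ∀ t, jet3 w c₃ t = jet3 w 0 t + c₃ := fun t => by rw [jet3, jet3]; ring
  rw [jet2, jet2]
  simp only [h2]
  rw [intervalIntegral.integral_add h1 intervalIntegrable_const, intervalIntegral.integral_const,
    smul_eq_mul]
  ring

/-- `J J*` inverts `A`. -/
lemma hasA_adjoint (h : IsDegenerate a) (w : L2w a) :
    HasA (liftDD h ((opJW h).adjoint w)) w := by
  set p : ddSpace := (opJW h).adjoint w with hp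
  obtain ⟨C, -, hC⟩ := exists_jet2_bound h w 0 0
  have mF : MemLp (jet2 w 0 0) 2 unitVol := by
    refine MemLp.of_bound (aestronglyMeasurable_of_continuousOn (continuousOn_jet2 h w 0 0)) C ?_
    filter_upwards [ae_restrict_mem measurableSet_Ioo] with x hx
    exact hC x (Ioo_subset_Ioc_self hx)
  -- For `q ∈ ddSpace` the boundary term in Green's formula vanishes, so `J* w` and the jet with
  -- zero constants have the same inner product with `q`. They therefore differ by an element of the
  -- double complement, which is the finite-dimensional span of `1` and `x`.
  have hmem : (p : L2) - mF.toLp ∈ ddSpaceᗮ := by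
    rw [Submodule.mem_orthogonal]
    intro q hq
    obtain ⟨q1, q2⟩ := mem_ddSpace.1 hq
    have e1 : inner ℝ p (⟨q, hq⟩ : ddSpace) = inner ℝ w (opJ h q) :=
      ContinuousLinearMap.adjoint_inner_left _ _ _
    rw [inner_opJ_eq h w 0 0 q q2, integral_jet2_mul mF.coeFn_toLp] at e1
    have e2 : inner ℝ p (⟨q, hq⟩ : ddSpace) = inner ℝ (p : L2) q := rfl
    rw [real_inner_comm, inner_sub_left, ← e2, e1]
    simp
  have : FiniteDimensional ℝ (Submodule.span ℝ {oneL2, idL2}) :=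
    FiniteDimensional.span_of_finite ℝ (toFinite _)
  rw [Submodule.orthogonal_orthogonal] at hmem
  obtain ⟨α, β, hαβ⟩ := Submodule.mem_span_pair.1 hmem
  -- The jets are based at `1`, and `α + βx = (α + β) + β(x - 1)`.
  refine hasA_of_jet h (c₃ := β) (c₂ := α + β) ?_
  rw [dd_liftDD]
  have e3 : (p : L2) = (α • oneL2 + β • idL2) + mF.toLp := by rw [hαβ]; abel
  have h1 : oneL2 =ᵐ[unitVol] fun _ => 1 := MemLp.coeFn_toLp _
  have h2 : idL2 =ᵐ[unitVol] fun x => x := MemLp.coeFn_toLp _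
  rw [e3]
  filter_upwards [Lp.coeFn_add (α • oneL2 + β • idL2) mF.toLp, Lp.coeFn_add (α • oneL2) (β • idL2),
    Lp.coeFn_smul α oneL2, Lp.coeFn_smul β idL2, h1, h2, mF.coeFn_toLp,
    ae_restrict_mem measurableSet_Ioo] with x k1 k2 k3 k4 k5 k6 k7 k8
  rw [k1, Pi.add_apply, k2, Pi.add_apply, k3, Pi.smul_apply, k4, Pi.smul_apply, k5, k6, k7,
    jet2_eq_add h w β _ (Ioo_subset_Ioc_self k8)]
  simp only [smul_eq_mul]
  ring

/-- Separation of variables: if `A u = ν² u`, any amplitude with `c'' = -ν² c` gives a solution. -/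
lemma isClassicalSolution_smul {u : H2w a} {ν : ℝ} (hu : HasA u (ν ^ 2 • incl u)) {c c' : ℝ → ℝ}
    (hc : ∀ t, HasDerivAt c (c' t) t) (hc' : ∀ t, HasDerivAt c' (-ν ^ 2 * c t) t) :
    IsClassicalSolution a (fun t => c t • u) (fun t => c' t • u) := by
  have cc : Continuous c := continuous_iff_continuousAt.2 fun t => (hc t).continuousAt
  have cc' : Continuous c' := continuous_iff_continuousAt.2 fun t => (hc' t).continuousAt
  have h1 : ∀ t, HasDerivAt (fun t => c t • u) (c' t • u) t := fun t => (hc t).smul_const u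
  have h2 : ∀ t, HasDerivAt (fun t => c' t • incl u) ((-ν ^ 2 * c t) • incl u) t :=
    fun t => (hc' t).smul_const (incl u)
  have h3 : Continuous fun t => c' t • u := cc'.smul continuous_const
  have h4 : Continuous fun t => (-ν ^ 2 * c t) • incl u :=
    (continuous_const.mul cc).smul continuous_const
  refine ⟨fun t _ => (h1 t).hasDerivWithinAt, h3.continuousOn, _, h4.continuousOn,
    fun t _ => ⟨(h2 t).hasDerivWithinAt, ?_⟩⟩
  have := hu.smul (c t)
  rwa [smul_smul, show c t * ν ^ 2 = -(-ν ^ 2 * c t) by ring, neg_smul] at this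

lemma hasA_zero : HasA (0 : H2w a) 0 := by
  refine ⟨fun _ => 0, fun _ => 0, ?_, ?_, ?_⟩
  · exact ((IsPrimitiveOn.const 0).hasWeakDeriv).congr_left (Lp.coeFn_zero ℝ 2 unitVol).symm
  · exact (IsPrimitiveOn.const 0).hasWeakDeriv
  · filter_upwards [Lp.coeFn_zero ℝ 2 (wMeasure a)] with x hx
    rw [hx, mul_zero, Pi.zero_apply]

lemma isClassicalSolution_zero :
    IsClassicalSolution a (fun _ => (0 : H2w a)) (fun _ => (0 : H2w a)) := by
  refine ⟨fun t _ => hasDerivWithinAt_const t _ _, continuousOn_const, fun _ => 0,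
    continuousOn_const, fun t _ => ⟨hasDerivWithinAt_const t _ _, ?_⟩⟩
  rw [neg_zero]
  exact hasA_zero

/-- The initial data of classical solutions. -/
def classicalData (a : ℝ → ℝ) : Submodule ℝ (H2w a × L2w a) where
  carrier := {x | ∃ z zt, IsClassicalSolution a z zt ∧ z 0 = x.1 ∧ incl (zt 0) = x.2}
  zero_mem' := ⟨_, _, isClassicalSolution_zero, rfl, rfl⟩
  add_mem' := by
    rintro x y ⟨z, zt, h1, h2, h3⟩ ⟨v, vt, k1, k2, k3⟩
    exact ⟨_, _, h1.add k1, by rw [h2, k2, Prod.fst_add], by rw [incl_add, h3, k3, Prod.snd_add]⟩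
  smul_mem' := by
    rintro c x ⟨z, zt, h1, h2, h3⟩
    exact ⟨_, _, h1.smul c, by rw [h2, Prod.smul_fst], by rw [incl_smul, h3, Prod.smul_snd]⟩

/-- The amplitudes `cos(νt)` and `ν⁻¹ sin(νt)` excite the position and the velocity separately. -/
lemma mem_classicalData_of_hasA {u : H2w a} {ν : ℝ} (hν : ν ≠ 0)
    (hu : HasA u (ν ^ 2 • incl u)) :
    (u, 0) ∈ classicalData a ∧ (0, incl u) ∈ classicalData a := by
  have d : ∀ t : ℝ, HasDerivAt (fun t => ν * t) ν t := fun t => by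
    simpa using (hasDerivAt_id t).const_mul ν
  constructor
  · refine ⟨_, _, isClassicalSolution_smul hu (c := fun t => Real.cos (ν * t))
      (c' := fun t => -Real.sin (ν * t) * ν) (fun t => (d t).cos) (fun t => ?_), ?_, ?_⟩
    · exact (((d t).sin.neg).mul_const ν).congr_deriv (by ring)
    · simp
    · simp only [mul_zero, Real.sin_zero, neg_zero, zero_mul, zero_smul]
      rfl
  · refine ⟨_, _, isClassicalSolution_smul hu (c := fun t => ν⁻¹ * Real.sin (ν * t))
      (c' := fun t => Real.cos (ν * t)) (fun t => ?_) (fun t => ?_), ?_, ?_⟩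
    · exact ((d t).sin.const_mul ν⁻¹).congr_deriv (by field_simp)
    · exact ((d t).cos).congr_deriv (by field_simp)
    · simp
    · simp

/-- `J J*`, the inverse of `A`. -/
def opS (h : IsDegenerate a) : L2w a →L[ℝ] L2w a := (opJW h).comp (opJW h).adjoint

lemma isCompactOperator_opS (h : IsDegenerate a) : IsCompactOperator (opS h) :=
  ((isCompactOperator_opJ h).comp_clm ddSpace.subtypeL).comp_clm (opJW h).adjoint

lemma isSymmetric_opS (h : IsDegenerate a) : (opS h : L2w a →ₗ[ℝ] L2w a).IsSymmetric := by
  intro v w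
  change inner ℝ (opJW h ((opJW h).adjoint v)) w = inner ℝ v (opJW h ((opJW h).adjoint w))
  exact (ContinuousLinearMap.adjoint_inner_right _ _ _).symm.trans
    (ContinuousLinearMap.adjoint_inner_left _ _ _)

lemma adjoint_injective (h : IsDegenerate a) {w : L2w a} (hw : (opJW h).adjoint w = 0) : w = 0 := by
  refine eq_zero_of_inner_opJ h fun p hp => ?_
  have : inner ℝ ((opJW h).adjoint w) (⟨p, hp⟩ : ddSpace) = inner ℝ w (opJ h p) :=
    ContinuousLinearMap.adjoint_inner_left _ _ _
  rw [← this, hw, inner_zero_left]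

lemma mem_classicalData_of_eigenvector (h : IsDegenerate a) {e : L2w a} {μ : ℝ}
    (he : opS h e = μ • e) :
    (liftDD h ((opJW h).adjoint e), 0) ∈ classicalData a ∧ (0, e) ∈ classicalData a := by
  rcases eq_or_ne e 0 with rfl | hne
  · rw [map_zero, map_zero]
    exact ⟨zero_mem _, zero_mem _⟩
  set p := (opJW h).adjoint e with hp
  have hpne : p ≠ 0 := fun h0 => hne (adjoint_injective h h0)
  -- This gives `μ ‖e‖² = ‖J* e‖²`, so injectivity of `J*` forces `μ > 0` and the frequency is `ν =
  -- μ^(-1/2)`.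
  have h1 : inner ℝ e (opS h e) = ‖p‖ ^ 2 := by
    rw [← real_inner_self_eq_norm_sq]
    exact (ContinuousLinearMap.adjoint_inner_left (opJW h) p e).symm
  rw [he, real_inner_smul_right, real_inner_self_eq_norm_sq] at h1
  have hμ : 0 < μ := by
    have h2 : 0 < ‖p‖ ^ 2 := by positivity
    have h3 : 0 < ‖e‖ ^ 2 := by positivity
    rw [← h1] at h2
    exact pos_of_mul_pos_left h2 h3.le
  have hincl : incl (liftDD h p) = μ • e := he
  have hν : √(1 / μ) ^ 2 = 1 / μ := Real.sq_sqrt (by positivity)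
  have hA : HasA (liftDD h p) (√(1 / μ) ^ 2 • incl (liftDD h p)) := by
    rw [hincl, hν, smul_smul, one_div_mul_cancel hμ.ne', one_smul]
    exact hasA_adjoint h e
  obtain ⟨k1, k2⟩ := mem_classicalData_of_hasA (Real.sqrt_pos.2 (by positivity)).ne' hA
  refine ⟨k1, ?_⟩
  have k3 := (classicalData a).smul_mem μ⁻¹ k2
  rwa [hincl, Prod.smul_mk, smul_zero, smul_smul, inv_mul_cancel₀ hμ.ne', one_smul] at k3

/-- The spectral theorem for the compact symmetric operator `J J*`: its eigenspaces have trivial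
common orthogonal complement. -/
lemma eq_zero_of_orthogonal_eigenvectors (h : IsDegenerate a) {w : L2w a}
    (hw : ∀ (e : L2w a) (μ : ℝ), opS h e = μ • e → inner ℝ e w = 0) : w = 0 := by
  have h1 := ContinuousLinearMap.orthogonalComplement_iSup_eigenspaces_eq_bot
    (isCompactOperator_opS h) (isSymmetric_opS h)
  rw [← Submodule.mem_bot ℝ, ← h1, ← Submodule.iInf_orthogonal, Submodule.mem_iInf]
  intro μ
  rw [Submodule.mem_orthogonal]
  exact fun e he => hw e μ (Module.End.mem_eigenspace_iff.1 he)

/-- Initial data of classical solutions are dense. -/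
lemma dense_classicalData (h : IsDegenerate a) (x : H2w a × L2w a) :
    x ∈ (classicalData a).topologicalClosure := by
  have h2 : ((classicalData a).comap (LinearMap.inr ℝ (H2w a) (L2w a))).topologicalClosure = ⊤ := by
    rw [Submodule.topologicalClosure_eq_top_iff, Submodule.eq_bot_iff]
    refine fun w hw => eq_zero_of_orthogonal_eigenvectors h fun e μ he => ?_
    exact (Submodule.mem_orthogonal _ _).1 hw e (mem_classicalData_of_eigenvector h he).2
  -- Density in `H²_{1/a}` is tested on second derivatives in `ddSpace`: if `p` is orthogonal to
  -- every `J* e`, then `J p` is orthogonal to every eigenvector `e`, so `J p = 0` and `p = 0`.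
  have h1 : (((classicalData a).comap (LinearMap.inl ℝ (H2w a) (L2w a))).comap
      (liftDD h : ddSpace →ₗ[ℝ] H2w a)).topologicalClosure = ⊤ := by
    rw [Submodule.topologicalClosure_eq_top_iff, Submodule.eq_bot_iff]
    intro p hp
    have h3 : opJW h p = 0 := by
      refine eq_zero_of_orthogonal_eigenvectors h fun e μ he => ?_
      rw [← ContinuousLinearMap.adjoint_inner_left]
      exact (Submodule.mem_orthogonal _ _).1 hp _ (mem_classicalData_of_eigenvector h he).1
    exact Subtype.ext (opJ_injective h h3)
  obtain ⟨u, v⟩ := x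
  obtain ⟨p, rfl⟩ := liftDD_surjective h u
  have k1 : (liftDD h p, (0 : L2w a)) ∈ (classicalData a).topologicalClosure := by
    have hp : p ∈ (⊤ : Submodule ℝ ddSpace) := trivial
    rw [← h1] at hp
    exact map_mem_closure (f := fun p : ddSpace => (liftDD h p, (0 : L2w a)))
      ((liftDD h).continuous.prodMk continuous_const) hp fun q hq => hq
  have k2 : ((0 : H2w a), v) ∈ (classicalData a).topologicalClosure := by
    have hv : v ∈ (⊤ : Submodule ℝ (L2w a)) := trivial
    rw [← h2] at hv
    exact map_mem_closure (f := fun v : L2w a => ((0 : H2w a), v))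
      (continuous_const.prodMk continuous_id) hv fun q hq => hq
  simpa using Submodule.add_mem _ k1 k2

/-! ### The boundary trace -/

lemma norm_sq_Lp_Ioo {T : ℝ} (g : Lp ℝ 2 ((volume : Measure ℝ).restrict (Ioo 0 T))) :
    ‖g‖ ^ 2 = ∫ t in Ioo (0 : ℝ) T, g t ^ 2 := by
  rw [← real_inner_self_eq_norm_sq, MeasureTheory.L2.inner_def]
  simp only [pow_two]
  rfl

/-- The observation of a classical solution exists in `L²(0,T)`. -/
lemma IsClassicalSolution.exists_observation (h : IsDegenerate a) {y yt : ℝ → H2w a}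
    (hy : IsClassicalSolution a y yt) (T : ℝ) :
    ∃ b : Lp ℝ 2 ((volume : Measure ℝ).restrict (Ioo 0 T)),
      ∀ᵐ t ∂(volume : Measure ℝ).restrict (Ioo 0 T), HasSecondDerivAtOne (y t) (b t) := by
  obtain ⟨τ, cτ, hτ, -⟩ := hy.exists_trace h
  have c1 : ContinuousOn τ (Icc 0 T) := cτ.mono Icc_subset_Ici_self
  have m : MemLp τ 2 (volume.restrict (Ioo 0 T)) := by
    rw [memLp_two_iff_integrable_sq ((c1.mono Ioo_subset_Icc_self).aestronglyMeasurable
      measurableSet_Ioo)]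
    exact ((c1.pow 2).integrableOn_Icc).mono_set Ioo_subset_Icc_self
  refine ⟨m.toLp, ?_⟩
  filter_upwards [m.coeFn_toLp, ae_restrict_mem measurableSet_Ioo] with t h1 ht
  rw [h1]
  exact hτ t ht.1.le

/-- The direct and the inverse inequality for the observation of a classical solution. -/
lemma IsClassicalSolution.observation_bounds (h : IsDegenerate a) {y yt : ℝ → H2w a}
    (hy : IsClassicalSolution a y yt) {T : ℝ} (hT : 0 < T)
    {b : Lp ℝ 2 ((volume : Measure ℝ).restrict (Ioo 0 T))}
    (hb : ∀ᵐ t ∂(volume : Measure ℝ).restrict (Ioo 0 T), HasSecondDerivAtOne (y t) (b t)) :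
    ‖b‖ ^ 2 ≤ (4 * √(1 / a 1) + 6 * T) * energy (y 0) (incl (yt 0)) ∧
    (T * (2 - degK a) - 4 * max 1 (max (4 / a 1) (4 * degK a / a 1))) *
      energy (y 0) (incl (yt 0)) ≤ ‖b‖ ^ 2 := by
  obtain ⟨τ, -, hτ, hτT⟩ := hy.exists_trace h
  have e : ‖b‖ ^ 2 = ∫ t in (0 : ℝ)..T, τ t ^ 2 := by
    rw [norm_sq_Lp_Ioo, intervalIntegral.integral_of_le hT.le, integral_Ioc_eq_integral_Ioo]
    refine integral_congr_ae ?_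
    filter_upwards [hb, ae_restrict_mem measurableSet_Ioo] with t h1 ht
    rw [h1.unique (hτ t ht.1.le)]
  rw [e]
  exact hτT T hT.le

lemma ae_hasSecondDerivAtOne_sub {T : ℝ} {y z : ℝ → H2w a}
    {b c : Lp ℝ 2 ((volume : Measure ℝ).restrict (Ioo 0 T))}
    (hb : ∀ᵐ t ∂(volume : Measure ℝ).restrict (Ioo 0 T), HasSecondDerivAtOne (y t) (b t))
    (hc : ∀ᵐ t ∂(volume : Measure ℝ).restrict (Ioo 0 T), HasSecondDerivAtOne (z t) (c t)) :
    ∀ᵐ t ∂(volume : Measure ℝ).restrict (Ioo 0 T),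
      HasSecondDerivAtOne (y t - z t) ((b - c : Lp ℝ 2 _) t) := by
  filter_upwards [hb, hc, Lp.coeFn_sub b c] with t h1 h2 h3
  rw [h3]
  exact h1.sub h2

lemma continuous_energy (h : IsDegenerate a) :
    Continuous fun x : H2w a × L2w a => energy x.1 x.2 := by
  simp only [energy_eq h]
  have h1 : Continuous fun x : H2w a × L2w a => dd x.1 := (ddL a).continuous.comp continuous_fst
  exact continuous_const.mul ((continuous_snd.norm.pow 2).add (h1.norm.pow 2))

/-- Observations of solutions with the same limit of initial data have the same limit. -/
lemma tendsto_observation_sub (h : IsDegenerate a) {T : ℝ} (hT : 0 < T) {ι : Type*} {l : Filter ι}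
    {y yt z zt : ι → ℝ → H2w a} {b c : ι → Lp ℝ 2 ((volume : Measure ℝ).restrict (Ioo 0 T))}
    (hy : ∀ i, IsClassicalSolution a (y i) (yt i)) (hz : ∀ i, IsClassicalSolution a (z i) (zt i))
    (hb : ∀ i, ∀ᵐ t ∂(volume : Measure ℝ).restrict (Ioo 0 T), HasSecondDerivAtOne (y i t) (b i t))
    (hc : ∀ i, ∀ᵐ t ∂(volume : Measure ℝ).restrict (Ioo 0 T), HasSecondDerivAtOne (z i t) (c i t))
    {u : H2w a} {v : L2w a} (hy0 : Tendsto (fun i => y i 0) l (𝓝 u))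
    (hz0 : Tendsto (fun i => z i 0) l (𝓝 u)) (hy1 : Tendsto (fun i => incl (yt i 0)) l (𝓝 v))
    (hz1 : Tendsto (fun i => incl (zt i 0)) l (𝓝 v)) :
    Tendsto (fun i => b i - c i) l (𝓝 0) := by
  have h1 : Tendsto (fun i => energy (y i 0 - z i 0) (incl (yt i 0 - zt i 0))) l (𝓝 0) := by
    have h2 := ((continuous_energy h).tendsto (u - u, v - v)).comp
      ((hy0.sub hz0).prodMk_nhds (hy1.sub hz1))
    have h3 : energy (u - u) (v - v) = 0 := by
      rw [energy_eq h, dd_sub, sub_self, sub_self]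
      simp
    simp only [h3] at h2
    exact h2
  -- By linearity the difference is a classical solution with observation `b i - c i`, and the
  -- direct inequality bounds it by its initial energy.
  have h4 : Tendsto (fun i => ‖b i - c i‖ ^ 2) l (𝓝 0) := by
    refine squeeze_zero (fun i => by positivity) (fun i => (((hy i).sub (hz i)).observation_bounds h
      hT (ae_hasSecondDerivAtOne_sub (hb i) (hc i))).1) ?_
    simpa using h1.const_mul (4 * √(1 / a 1) + 6 * T)
  rw [tendsto_zero_iff_norm_tendsto_zero]
  have h5 := (Real.continuous_sqrt.tendsto 0).comp h4
  simpa [Function.comp_def, Real.sqrt_sq] using h5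

theorem exists_isBoundaryTrace (h : IsDegenerate a) {T : ℝ} (hT : 0 < T) (u : H2w a) (v : L2w a) :
    ∃ g, IsBoundaryTrace T u v g := by
  obtain ⟨x, hx, hlim⟩ := mem_closure_iff_seq_limit.1 (dense_classicalData h (u, v))
  choose z zt hz hz0 hz1 using hx
  choose b hb using fun n => (hz n).exists_observation h T
  have l0 : Tendsto (fun n => z n 0) atTop (𝓝 u) := by
    simp only [hz0]
    exact (continuous_fst.tendsto _).comp hlim
  have l1 : Tendsto (fun n => incl (zt n 0)) atTop (𝓝 v) := by
    simp only [hz1]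
    exact (continuous_snd.tendsto _).comp hlim
  have hcau : CauchySeq b := by
    rw [cauchySeq_iff_tendsto_dist_atTop_0, ← prod_atTop_atTop_eq]
    -- The Cauchy property is the same comparison indexed by pairs `(m, n)`, both members being
    -- taken from the one approximating sequence.
    have := tendsto_observation_sub h hT (l := atTop ×ˢ atTop) (y := fun n : ℕ × ℕ => z n.1)
      (z := fun n => z n.2) (fun n => hz n.1) (fun n => hz n.2) (fun n => hb n.1) (fun n => hb n.2)
      (l0.comp tendsto_fst) (l0.comp tendsto_snd) (l1.comp tendsto_fst)
      (l1.comp tendsto_snd)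
    simp only [dist_eq_norm]
    simpa using this.norm
  obtain ⟨g, hg⟩ := cauchySeq_tendsto_of_complete hcau
  exact ⟨g, z, zt, b, hz, l0, l1, hb, hg⟩

theorem IsBoundaryTrace.unique (h : IsDegenerate a) {T : ℝ} (hT : 0 < T) {u : H2w a} {v : L2w a}
    {g g' : Lp ℝ 2 ((volume : Measure ℝ).restrict (Ioo 0 T))} (hg : IsBoundaryTrace T u v g)
    (hg' : IsBoundaryTrace T u v g') : g = g' := by
  obtain ⟨z, zt, b, hz, l0, l1, hb, hbg⟩ := hg
  obtain ⟨z', zt', b', hz', l0', l1', hb', hbg'⟩ := hg'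
  have h1 := tendsto_observation_sub h hT hz hz' hb hb' l0 l0' l1 l1'
  exact sub_eq_zero.1 (tendsto_nhds_unique (hbg.sub hbg') h1)

/-- The observability inequality. -/
theorem IsBoundaryTrace.observability (h : IsDegenerate a) {T : ℝ} (hT : 0 < T) {u : H2w a}
    {v : L2w a} {g : Lp ℝ 2 ((volume : Measure ℝ).restrict (Ioo 0 T))}
    (hg : IsBoundaryTrace T u v g) :
    (T * (2 - degK a) - 4 * max 1 (max (4 / a 1) (4 * degK a / a 1))) * energy u v ≤
      ∫ t in Ioo (0 : ℝ) T, g t ^ 2 := by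
  obtain ⟨z, zt, b, hz, l0, l1, hb, hbg⟩ := hg
  rw [← norm_sq_Lp_Ioo]
  refine le_of_tendsto_of_tendsto' ((((continuous_energy h).tendsto (u, v)).comp
    (l0.prodMk_nhds l1)).const_mul _) (hbg.norm.pow 2) fun n => ?_
  exact ((hz n).observation_bounds h hT (hb n)).2

end DegBeam

end

theorem mainTheorem3 (a : ℝ → ℝ)
    (ha : DegBeam.WeaklyDegenerate a ∨ DegBeam.StronglyDegenerate a)
    (y : ℝ → DegBeam.H2w a) (yt : ℝ → DegBeam.L2w a)
    (hy : DegBeam.IsMildSolution a y yt) (T : ℝ) (hT : 0 < T) :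
    (∃! g : Lp ℝ 2 ((volume : Measure ℝ).restrict (Ioo 0 T)),
      DegBeam.IsBoundaryTrace T (y 0) (yt 0) g) ∧
    ∀ g : Lp ℝ 2 ((volume : Measure ℝ).restrict (Ioo 0 T)),
      DegBeam.IsBoundaryTrace T (y 0) (yt 0) g →
        (T * (2 - DegBeam.degK a)
            - 4 * max 1 (max (4 / a 1) (4 * DegBeam.degK a / a 1))) *
          DegBeam.energy (y 0) (yt 0) ≤ ∫ t in Ioo (0 : ℝ) T, (g t) ^ 2 := by
  have h : DegBeam.IsDegenerate a := ha.elim (fun h => h.isDegenerate) fun h => h.isDegenerate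
  obtain ⟨g, hg⟩ := DegBeam.exists_isBoundaryTrace h hT (y 0) (yt 0)
  exact ⟨⟨g, hg, fun g' hg' => hg'.unique h hT hg⟩, fun g' hg' => hg'.observability h hT⟩
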